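/- Let $k\ge 1$ be an integer and $0\le\alpha<1$, and let $\mathbb D=\{z\in\mathbb C:|z|<1\}$. Let $S_{LH}^{k*}(\alpha)$ be the class of univalent functions $f:\mathbb D\to\mathbb C$ of the form $f(z)=z\,h(z)\,\overline{g(z)}$, where $$h(z)=\exp\Big(\sum_{n=1}^\infty a_{nk}z^{nk}\Big),\qquad g(z)=\exp\Big(\sum_{n=1}^\infty b_{nk}z^{nk}\Big)$$ are analytic in $\mathbb D$, such that - $f$ is $k$-fold symmetric: $f(e^{2\pi i/k}z)=e^{2\pi i/k}f(z)$ for $z\in\mathbb D$; - $f$ is logharmonic: there is an analytic $\omega$ on $\mathbb D$ with $|\omega|<1$ and $\overline{f_{\bar z}}/\overline{f}=\omega\, f_z/f$ on $\mathbb D\setminus\{0\}$; - $f$ is starlike of order $\alpha$: $\operatorname{Re}\dfrac{z f_z(z)-\bar z f_{\bar z}(z)}{f(z)}>\alpha$ for all $z\in\mathbb D\setminus\{0\}$. **Theorem.** Let $f\in S_{LH}^{k*}(\alpha)$, let $0\le r<1$, and let $\mathbb D_r=\{z\in\mathbb C:|z|<r\}$. Then the area (planar Lebesgue measure) $Ar$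 of $f(\mathbb D_r)$ is finite and satisfies $$2\pi L_1\le Ar\le 2\pi L_2,$$ where $$L_1=\int_0^r\Big(\frac{1-(1-2\alpha)\rho^k}{(1+\rho^k)^{2(\alpha+k)/k}}\Big)^2\exp\Big(\frac{-8(1-\alpha)\rho^k}{k(1+\rho^k)}\Big)\rho\,d\rho-\int_0^r\Big(\frac{\rho^k(1+(1-2\alpha)\rho^k)}{(1-\rho^k)^{2(\alpha+k)/k}}\Big)^2\exp\Big(\frac{8(1-\alpha)\rho^k}{k(1-\rho^k)}\Big)\rho\,d\rho$$ and $$L_2=\int_0^r\Big(\frac{1+(1-2\alpha)\rho^k}{(1-\rho^k)^{2(\alpha+k)/k}}\Big)^2\exp\Big(\frac{8(1-\alpha)\rho^k}{k(1-\rho^k)}\Big)\rho\,d\rho-\int_0^r\Big(\frac{\rho^k(1-(1-2\alpha)\rho^k)}{(1+\rho^k)^{2(\alpha+k)/k}}\Big)^2\exp\Big(\frac{-8(1-\alpha)\rho^k}{k(1+\rho^k)}\Big)\rho\,d\rho.$$ -/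

import Mathlib

open scoped ComplexConjugate

noncomputable section

namespace Logharmonic

/-- The open unit disk. -/
def unitDisk : Set ℂ := Metric.ball 0 1

/-- Wirtinger derivative `f_z = (f_x - i f_y) / 2`. -/
def dz (f : ℂ → ℂ) (z : ℂ) : ℂ :=
  (fderiv ℝ f z 1 - Complex.I * fderiv ℝ f z Complex.I) / 2

/-- Wirtinger derivative `f_{z̄} = (f_x + i f_y) / 2`. -/
def dzbar (f : ℂ → ℂ) (z : ℂ) : ℂ :=
  (fderiv ℝ f z 1 + Complex.I * fderiv ℝ f z Complex.I) / 2

/-- `f` solves `conj (f_{z̄}) / conj f = ω * (f_z / f)` in the unit disk (away from the zeros of `f`,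
where the quotients are meaningless), with `ω` analytic and `|ω| < 1`; that is, `f` is logharmonic
with second dilatation `ω`. -/
def HasSecondDilatation (f ω : ℂ → ℂ) : Prop :=
  DifferentiableOn ℂ ω unitDisk ∧ (∀ z ∈ unitDisk, ‖ω z‖ < 1) ∧
    ∀ z ∈ unitDisk, f z ≠ 0 →
      DifferentiableAt ℝ f z ∧ conj (dzbar f z) / conj (f z) = ω z * (dz f z / f z)

/-- `f` is logharmonic in the unit disk. -/
def IsLogharmonic (f : ℂ → ℂ) : Prop := ∃ ω : ℂ → ℂ, HasSecondDilatation f ω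

/-- `f (e^{2πi/k} z) = e^{2πi/k} f z` in the unit disk. -/
def IsKFoldSymmetric (k : ℕ) (f : ℂ → ℂ) : Prop :=
  ∀ z ∈ unitDisk, f (Complex.exp (2 * Real.pi * Complex.I / k) * z) =
    Complex.exp (2 * Real.pi * Complex.I / k) * f z

/-- `h z = exp (∑_{n ≥ 1} a_{nk} z^{nk})` in the unit disk, the series being convergent there. -/
def IsExpKSeries (k : ℕ) (h : ℂ → ℂ) : Prop :=
  ∃ a : ℕ → ℂ, ∀ z ∈ unitDisk, ∃ s : ℂ,
    HasSum (fun n : ℕ => a ((n + 1) * k) * z ^ ((n + 1) * k)) s ∧ h z = Complex.exp s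

/-- `Re (D f / f) > α` in the punctured unit disk, where `D = z ∂/∂z - z̄ ∂/∂z̄`. -/
def IsStarlikeOfOrder (α : ℝ) (f : ℂ → ℂ) : Prop :=
  ∀ z ∈ unitDisk, z ≠ 0 → α < ((z * dz f z - conj z * dzbar f z) / f z).re

/-- The class `S_LH^{k*}(α)`: univalent, `k`-fold symmetric, logharmonic mappings of the unit disk,
starlike of order `α`, of the form `f z = z * h z * conj (g z)` with `h` and `g` exponentials of
power series in `z ^ k` without constant term. -/
structure SLHkStar (k : ℕ) (α : ℝ) (f : ℂ → ℂ) : Prop where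
  univalent : Set.InjOn f unitDisk
  symmetric : IsKFoldSymmetric k f
  logharmonic : IsLogharmonic f
  starlike : IsStarlikeOfOrder α f
  form : ∃ h g : ℂ → ℂ, DifferentiableOn ℂ h unitDisk ∧ DifferentiableOn ℂ g unitDisk ∧
    IsExpKSeries k h ∧ IsExpKSeries k g ∧ ∀ z ∈ unitDisk, f z = z * h z * conj (g z)

/-- The radial integral in the lower area bound. -/
def L₁ (k : ℕ) (α r : ℝ) : ℝ :=
  (∫ ρ in (0 : ℝ)..r,
      ((1 - (1 - 2 * α) * ρ ^ k) / (1 + ρ ^ k) ^ (2 * (α + k) / k)) ^ 2 *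
        Real.exp (-8 * (1 - α) * ρ ^ k / (k * (1 + ρ ^ k))) * ρ) -
    ∫ ρ in (0 : ℝ)..r,
      (ρ ^ k * (1 + (1 - 2 * α) * ρ ^ k) / (1 - ρ ^ k) ^ (2 * (α + k) / k)) ^ 2 *
        Real.exp (8 * (1 - α) * ρ ^ k / (k * (1 - ρ ^ k))) * ρ

/-- The radial integral in the upper area bound. -/
def L₂ (k : ℕ) (α r : ℝ) : ℝ :=
  (∫ ρ in (0 : ℝ)..r,
      ((1 + (1 - 2 * α) * ρ ^ k) / (1 - ρ ^ k) ^ (2 * (α + k) / k)) ^ 2 *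
        Real.exp (8 * (1 - α) * ρ ^ k / (k * (1 - ρ ^ k))) * ρ) -
    ∫ ρ in (0 : ℝ)..r,
      (ρ ^ k * (1 - (1 - 2 * α) * ρ ^ k) / (1 + ρ ^ k) ^ (2 * (α + k) / k)) ^ 2 *
        Real.exp (-8 * (1 - α) * ρ ^ k / (k * (1 + ρ ^ k))) * ρ

end Logharmonic

end

/-! Put `w = z ^ k`, `h = exp (A w)`, `g = exp (B w)`, and let `H = 1 + k w A'` and `G = k w B'`.
Then `|f_z| = |hg| |H|` and `|f_z̄| = |hg| |G|`, so the Jacobian is `|hg|² (|H|² - |G|²)`, and the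
area is its integral over the disk because `f` is injective. Starlikeness says `Re (H - G) > α`, and
the dilatation condition gives `|G| < |H|` off the zeros of `H`. Hence `H - G = P = α + (1 - α) p`
and `H + G = P q` with `p`, `q` Carathéodory functions (`exists_isCaratheodory_of_dilatation`). All
estimates are then estimates on `p` and `q`, with `t = |w|`.

The factors `|H|`, `|G|` and `|H|² - |G|²` follow from the classical bounds on `p` and `q`. For
`|hg|`, note that `w (k (A + B))' = P q - 1`. The upper bound comes from integrating `|P q|` along a
ray. The lower bound is the hard point: `Re (p q)` can be negative, so the pointwise bound suggested
by `((1 - t) / (1 + t))²` fails, and only the integrated inequality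
`IsCaratheodory.neg_le_re_integral_mul` holds. It is linear in `p` and in `q` separately, so the
Schwarz integral formula, applied to each factor, reduces it to a pair of functions `(ζ + x) / (ζ -
x)`. For these it is an explicit extremal problem on a circle, solved in
`neg_le_re_integral_kernel`.

`SLHkStar.exists_jacobian_bounds` assembles radial bounds for the Jacobian;
`volume_image_ball_bounds` integrates them in polar coordinates. -/

open Complex Metric Real MeasureTheory Set

/-! ### Carathéodory functions: growth bounds and the Schwarz integral formula -/

/-- The Carathéodory class: holomorphic functions of positive real part on the unit disk,
normalized by the value `1` at the origin. -/
structure IsCaratheodory (c : ℂ → ℂ) : Prop where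
  differentiableOn : DifferentiableOn ℂ c (ball 0 1)
  map_zero : c 0 = 1
  re_pos : ∀ z ∈ ball (0 : ℂ) 1, 0 < (c z).re

namespace IsCaratheodory

variable {c : ℂ → ℂ}

/-- The Cayley transform of a Carathéodory function satisfies the Schwarz lemma. -/
lemma norm_sub_one_le_mul (hc : IsCaratheodory c) {z : ℂ} (hz : ‖z‖ < 1) :
    ‖c z - 1‖ ≤ ‖z‖ * ‖c z + 1‖ := by
  have hne : ∀ x ∈ ball (0 : ℂ) 1, c x + 1 ≠ 0 := by
    intro x hx h
    have h1 := hc.re_pos x hx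
    have h2 := congrArg Complex.re h
    simp at h2
    linarith
  have hle : ∀ x ∈ ball (0 : ℂ) 1, ‖c x - 1‖ ≤ ‖c x + 1‖ := by
    intro x hx
    have h1 := hc.re_pos x hx
    rw [← sq_le_sq₀ (norm_nonneg _) (norm_nonneg _), ← normSq_eq_norm_sq, ← normSq_eq_norm_sq,
      normSq_apply, normSq_apply]
    simp
    nlinarith
  have hd : DifferentiableOn ℂ (fun x => (c x - 1) / (c x + 1)) (ball 0 1) :=
    (hc.differentiableOn.sub_const 1).div (hc.differentiableOn.add_const 1) hne
  have key := Complex.norm_le_norm_of_mapsTo_ball hd (fun x hx => by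
    rw [mem_closedBall_zero_iff, norm_div]
    exact div_le_one_of_le₀ (hle x hx) (norm_nonneg _)) (by simp [hc.map_zero]) hz
  have hz' : z ∈ ball (0 : ℂ) 1 := by simpa using hz
  rwa [norm_div, div_le_iff₀ (norm_pos_iff.2 (hne z hz'))] at key

lemma norm_sub_one_le (hc : IsCaratheodory c) {z : ℂ} (hz : ‖z‖ < 1) :
    ‖c z - 1‖ ≤ 2 * ‖z‖ / (1 - ‖z‖) := by
  have h := hc.norm_sub_one_le_mul hz
  have h2 : ‖c z + 1‖ ≤ ‖c z - 1‖ + 2 := by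
    calc ‖c z + 1‖ = ‖(c z - 1) + 2‖ := by ring_nf
      _ ≤ _ := (norm_add_le _ _).trans (by simp)
  rw [le_div_iff₀ (by linarith)]
  nlinarith [norm_nonneg z]

lemma norm_le (hc : IsCaratheodory c) {z : ℂ} (hz : ‖z‖ < 1) :
    ‖c z‖ ≤ (1 + ‖z‖) / (1 - ‖z‖) := by
  calc ‖c z‖ = ‖(c z - 1) + 1‖ := by ring_nf
    _ ≤ ‖c z - 1‖ + 1 := (norm_add_le _ _).trans (by simp)
    _ ≤ 2 * ‖z‖ / (1 - ‖z‖) + 1 := by gcongr; exact hc.norm_sub_one_le hz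
    _ = _ := by
      have : 1 - ‖z‖ ≠ 0 := by linarith
      field_simp
      ring

lemma le_re (hc : IsCaratheodory c) {z : ℂ} (hz : ‖z‖ < 1) :
    (1 - ‖z‖) / (1 + ‖z‖) ≤ (c z).re := by
  have h := hc.norm_sub_one_le_mul hz
  have hp := hc.re_pos z (by simpa using hz)
  have h0 := norm_nonneg z
  have h' : ‖c z - 1‖ ^ 2 ≤ ‖z‖ ^ 2 * ‖c z + 1‖ ^ 2 := by
    rw [← mul_pow]; gcongr
  rw [← normSq_eq_norm_sq (c z - 1), ← normSq_eq_norm_sq (c z + 1), normSq_apply,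
    normSq_apply] at h'
  simp only [sub_re, one_re, sub_im, one_im, sub_zero, add_re, add_im, add_zero] at h'
  rw [div_le_iff₀ (by linarith)]
  set t := ‖z‖
  set x := (c z).re
  set y := (c z).im
  -- The imaginary part contributes `y²` on the left and only `t² y²` on the right, so it can be
  -- dropped.
  have h3 : (x - 1) * (x - 1) ≤ t ^ 2 * ((x + 1) * (x + 1)) := by
    nlinarith [mul_nonneg (sub_nonneg.2 (show t ^ 2 ≤ 1 by nlinarith)) (mul_self_nonneg y)]
  have h4 : |x - 1| ≤ t * (x + 1) := by
    apply abs_le_of_sq_le_sq _ (by positivity)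
    nlinarith
  have := (abs_le.1 h4).1
  nlinarith

/-- The Schwarz integral formula, in the form of a representation of the difference quotient. -/
lemma dslope_eq_circleAverage (hc : IsCaratheodory c) {R : ℝ} (hR1 : R < 1) {x : ℂ}
    (hx0 : x ≠ 0) (hx : ‖x‖ < R) :
    dslope c 0 x = circleAverage (fun ζ => 2 * ((c ζ).re : ℂ) / (ζ - x)) 0 R := by
  have hR : 0 < R := (norm_nonneg x).trans_lt hx
  have hsub : closedBall (0 : ℂ) R ⊆ ball 0 1 := closedBall_subset_ball hR1
  have hcl : DiffContOnCl ℂ c (ball 0 |R|) := by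
    apply DifferentiableOn.diffContOnCl
    rw [abs_of_pos hR, closure_ball _ hR.ne']
    exact hc.differentiableOn.mono hsub
  have hcont : ContinuousOn c (sphere 0 R) :=
    hc.differentiableOn.continuousOn.mono (sphere_subset_closedBall.trans hsub)
  have hne : ∀ ζ ∈ sphere (0 : ℂ) R, ζ - x ≠ 0 := by
    intro ζ hζ h
    rw [sub_eq_zero] at h
    rw [mem_sphere_zero_iff_norm, h] at hζ
    linarith
  have hxR : x ∈ ball (0 : ℂ) |R| := by simpa [abs_of_pos hR] using hx
  have e1 : circleAverage (fun ζ => ((ζ - 0) / (ζ - x)) • c ζ) 0 R = c x :=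
    hcl.circleAverage_smul_div hxR
  have hne2 : ∀ ζ ∈ closedBall (0 : ℂ) R, (R : ℂ) ^ 2 - conj x * ζ ≠ 0 := by
    intro ζ hζ h
    rw [sub_eq_zero] at h
    have := congrArg norm h
    rw [mem_closedBall_zero_iff] at hζ
    simp [abs_of_pos hR] at this
    nlinarith [norm_nonneg x, norm_nonneg ζ]
  -- The averaged function is holomorphic and takes the value `c 0 = 1` at the centre. Since `R² = ζ
  -- ζ̄` on the circle, its conjugate there is the integrand of `e3`.
  have e2 : circleAverage (fun ζ => (R : ℂ) ^ 2 / ((R : ℂ) ^ 2 - conj x * ζ) * c ζ) 0 R = 1 := by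
    have hd : DiffContOnCl ℂ (fun ζ => (R : ℂ) ^ 2 / ((R : ℂ) ^ 2 - conj x * ζ) * c ζ)
        (ball 0 |R|) := by
      apply DifferentiableOn.diffContOnCl
      rw [abs_of_pos hR, closure_ball _ hR.ne']
      refine DifferentiableOn.mul (DifferentiableOn.div (by fun_prop) (by fun_prop) hne2)
        (hc.differentiableOn.mono hsub)
    rw [hd.circleAverage]
    simp [hc.map_zero, hR.ne']
  have hci : CircleIntegrable (fun ζ => (R : ℂ) ^ 2 / ((R : ℂ) ^ 2 - conj x * ζ) * c ζ) 0 R :=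
    ContinuousOn.circleIntegrable hR.le
      (ContinuousOn.mul (ContinuousOn.div (by fun_prop) (by fun_prop)
        fun ζ hζ => hne2 ζ (sphere_subset_closedBall hζ)) hcont)
  have e3 : circleAverage (fun ζ => (ζ / (ζ - x)) * conj (c ζ)) 0 R = 1 := by
    have h := (conjCLE : ℂ →L[ℝ] ℂ).circleAverage_comp_comm hci
    rw [e2] at h
    simp only [ContinuousLinearEquiv.coe_coe, conjCLE_apply, map_one] at h
    rw [← h]
    apply circleAverage_congr_sphere
    intro ζ hζ
    rw [abs_of_pos hR] at hζ
    have hζn : ζ * conj ζ = (R : ℂ) ^ 2 := by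
      rw [mul_conj, normSq_eq_norm_sq, mem_sphere_zero_iff_norm.1 hζ]; push_cast; rfl
    have hζ0 : conj ζ ≠ 0 := by
      intro h0; rw [h0, mul_zero] at hζn
      exact hR.ne' (by exact_mod_cast (pow_eq_zero_iff (two_ne_zero)).1 hζn.symm)
    simp only [Function.comp_apply, conjCLE_apply, map_mul, map_div₀, map_sub, conj_conj,
      map_pow, conj_ofReal]
    rw [← hζn, show ζ * conj ζ - x * conj ζ = (ζ - x) * conj ζ by ring,
      mul_div_mul_right _ _ hζ0]
  have hi1 : CircleIntegrable (fun ζ => (ζ / (ζ - x)) * c ζ) 0 R :=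
    ContinuousOn.circleIntegrable hR.le
      ((ContinuousOn.div (by fun_prop) (by fun_prop) hne).mul hcont)
  have hi2 : CircleIntegrable (fun ζ => (ζ / (ζ - x)) * conj (c ζ)) 0 R :=
    ContinuousOn.circleIntegrable hR.le
      ((ContinuousOn.div (by fun_prop) (by fun_prop) hne).mul
        (Complex.continuous_conj.comp_continuousOn hcont))
  have hi3 : CircleIntegrable (fun ζ => c ζ) 0 R := ContinuousOn.circleIntegrable hR.le hcont
  have hi4 : CircleIntegrable (fun ζ => conj (c ζ)) 0 R :=
    ContinuousOn.circleIntegrable hR.le (Complex.continuous_conj.comp_continuousOn hcont)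
  have e4 : circleAverage (fun ζ => c ζ) 0 R = 1 := by
    rw [hcl.circleAverage, hc.map_zero]
  have e5 : circleAverage (fun ζ => conj (c ζ)) 0 R = 1 := by
    have h := (conjCLE : ℂ →L[ℝ] ℂ).circleAverage_comp_comm hi3
    rw [e4] at h
    simpa [Function.comp_def] using h
  -- The integrand is `2 Re c(ζ) · (ζ / (ζ - x) - 1)`, that is `x` times the integrand of the claim.
  have e6 : circleAverage (fun ζ => ((ζ / (ζ - x)) * c ζ + (ζ / (ζ - x)) * conj (c ζ)) -
      (c ζ + conj (c ζ))) 0 R = c x - 1 := by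
    have hs1 : CircleIntegrable (fun ζ => (ζ / (ζ - x)) * c ζ + (ζ / (ζ - x)) * conj (c ζ)) 0 R :=
      hi1.add hi2
    have hs2 : CircleIntegrable (fun ζ => c ζ + conj (c ζ)) 0 R := hi3.add hi4
    rw [circleAverage_fun_sub hs1 hs2, circleAverage_fun_add hi1 hi2,
      circleAverage_fun_add hi3 hi4, e3, e4, e5]
    simp only [sub_zero, smul_eq_mul] at e1
    rw [e1]; ring
  rw [dslope_of_ne _ hx0, slope_def_field, hc.map_zero, sub_zero, ← e6, div_eq_inv_mul,
    ← smul_eq_mul, ← circleAverage_fun_smul]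
  apply circleAverage_congr_sphere
  intro ζ hζ
  rw [abs_of_pos hR] at hζ
  have h1 := hne ζ hζ
  have h2 : (2 * ((c ζ).re : ℂ)) = c ζ + conj (c ζ) := by
    rw [Complex.add_conj]; push_cast; rfl
  simp only [smul_eq_mul, h2]
  field_simp
  ring

/-- With positivity, this makes `Re c` a probability density on the circle, so averaging against it
preserves lower bounds. -/
lemma circleAverage_re (hc : IsCaratheodory c) {R : ℝ} (hR : 0 < R) (hR1 : R < 1) :
    circleAverage (fun ζ => (c ζ).re) 0 R = 1 := by
  have hsub : closedBall (0 : ℂ) R ⊆ ball 0 1 := closedBall_subset_ball hR1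
  have hcl : DiffContOnCl ℂ c (ball 0 |R|) := by
    apply DifferentiableOn.diffContOnCl
    rw [abs_of_pos hR, closure_ball _ hR.ne']
    exact hc.differentiableOn.mono hsub
  have hi : CircleIntegrable c 0 R := ContinuousOn.circleIntegrable hR.le
    (hc.differentiableOn.continuousOn.mono (sphere_subset_closedBall.trans hsub))
  have h := reCLM.circleAverage_comp_comm hi
  rw [hcl.circleAverage, hc.map_zero] at h
  simpa [Function.comp_def] using h

end IsCaratheodory

/-! ### Reduction to extreme points -/

/-- Radial integrals against the difference quotient of a Carathéodory function are bounded below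
by those of the extreme points `x ↦ (ζ + x) / (ζ - x)` of the class. -/
lemma IsCaratheodory.le_re_integral_weight_mul_dslope {c : ℂ → ℂ} (hc : IsCaratheodory c) {R : ℝ}
    (hR1 : R < 1) {w : ℂ} (hw0 : w ≠ 0) (hw : ‖w‖ < R) {g : ℝ → ℂ}
    (hg : ContinuousOn g (Icc 0 1)) {m : ℝ}
    (h : ∀ ζ : ℂ, ‖ζ‖ = R → m ≤ (∫ s in (0 : ℝ)..1, g s * (2 * w / (ζ - s * w))).re) :
    m ≤ (∫ s in (0 : ℝ)..1, g s * (w * dslope c 0 (s * w))).re := by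
  have hR : 0 < R := (norm_nonneg w).trans_lt hw
  have hsw : ∀ s ∈ Icc (0 : ℝ) 1, ‖(s : ℂ) * w‖ < R := by
    intro s hs
    rw [norm_mul, norm_real, Real.norm_of_nonneg hs.1]
    nlinarith [hs.2, norm_nonneg w]
  have hne : ∀ s ∈ Icc (0 : ℝ) 1, ∀ ζ ∈ sphere (0 : ℂ) R, ζ - s * w ≠ 0 := by
    intro s hs ζ hζ h0
    have := hsw s hs
    rw [← sub_eq_zero.1 h0, mem_sphere_zero_iff_norm.1 hζ] at this
    exact lt_irrefl _ this
  have hmem : ∀ θ, circleMap 0 R θ ∈ sphere (0 : ℂ) R := circleMap_mem_sphere 0 hR.le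
  have hcS : ContinuousOn c (sphere 0 R) := hc.differentiableOn.continuousOn.mono
    (sphere_subset_closedBall.trans (closedBall_subset_ball hR1))
  have hccirc : Continuous fun θ => c (circleMap 0 R θ) :=
    hcS.comp_continuous (continuous_circleMap 0 R) hmem
  set K : ℝ → ℝ → ℂ := fun s θ => g s * (2 * w / (circleMap 0 R θ - s * w)) with hK
  set F : ℝ → ℝ → ℝ := fun s θ => (c (circleMap 0 R θ)).re * (K s θ).re with hF
  have hKc : ContinuousOn (Function.uncurry K) (Icc 0 1 ×ˢ univ) := by
    refine ContinuousOn.mul (hg.comp continuousOn_fst fun x hx => hx.1) ?_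
    refine ContinuousOn.div continuousOn_const ?_ fun x hx => hne x.1 hx.1 _ (hmem x.2)
    exact (((continuous_circleMap 0 R).comp continuous_snd).sub
      ((continuous_ofReal.comp continuous_fst).mul continuous_const)).continuousOn
  have hFc : ContinuousOn (Function.uncurry F) (Icc 0 1 ×ˢ univ) :=
    (continuous_re.comp (hccirc.comp continuous_snd)).continuousOn.mul
      (continuous_re.comp_continuousOn hKc)
  have hFi : IntegrableOn (Function.uncurry F) (uIoc 0 1 ×ˢ uIoc 0 (2 * π)) := by
    rw [uIoc_of_le zero_le_one, uIoc_of_le two_pi_pos.le]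
    exact ((hFc.mono (prod_mono le_rfl (subset_univ _))).integrableOn_compact
      (isCompact_Icc.prod isCompact_Icc)).mono_set (prod_mono Ioc_subset_Icc_self Ioc_subset_Icc_self)
  -- The endpoint `s = 0` is left out because the Schwarz formula for the difference quotient needs
  -- a nonzero point; it is negligible for the integral.
  have hstep : ∀ s ∈ Ioc (0 : ℝ) 1, (g s * (w * dslope c 0 (s * w))).re =
      (2 * π)⁻¹ * ∫ θ in (0 : ℝ)..2 * π, F s θ := by
    intro s hs
    have hs' := Ioc_subset_Icc_self hs
    rw [hc.dslope_eq_circleAverage hR1 (mul_ne_zero (by exact_mod_cast hs.1.ne') hw0) (hsw s hs'),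
      ← mul_assoc, ← smul_eq_mul (g s * w), ← circleAverage_fun_smul]
    have hi : CircleIntegrable
        (fun ζ => (g s * w) • (2 * ((c ζ).re : ℂ) / (ζ - s * w))) 0 R := by
      refine ContinuousOn.circleIntegrable hR.le ?_
      simp only [smul_eq_mul]
      refine continuousOn_const.mul ?_
      refine ContinuousOn.div (continuousOn_const.mul (continuous_ofReal.comp_continuousOn
        (continuous_re.comp_continuousOn hcS))) (by fun_prop) (hne s hs')
    have := reCLM.circleAverage_comp_comm hi
    simp only [reCLM_apply] at this
    rw [← this, circleAverage_def, smul_eq_mul]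
    congr 1
    refine intervalIntegral.integral_congr fun θ _ => ?_
    simp only [Function.comp_apply, reCLM_apply, hF, hK, smul_eq_mul]
    rw [← re_ofReal_mul]
    congr 1
    ring
  have hswap := intervalIntegral_intervalIntegral_swap hFi
  have hint : IntervalIntegrable (fun s : ℝ => g s * (w * dslope c 0 (s * w))) volume 0 1 := by
    refine ContinuousOn.intervalIntegrable ?_
    rw [uIcc_of_le zero_le_one]
    have hds : ContinuousOn (dslope c 0) (ball 0 1) :=
      ((Complex.differentiableOn_dslope (ball_mem_nhds 0 one_pos)).2
        hc.differentiableOn).continuousOn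
    refine hg.mul (continuousOn_const.mul (hds.comp (by fun_prop) fun s hs => ?_))
    simpa using (hsw s hs).trans hR1
  have hre : (∫ s in (0 : ℝ)..1, g s * (w * dslope c 0 (s * w))).re =
      (2 * π)⁻¹ * ∫ θ in (0 : ℝ)..2 * π, ∫ s in (0 : ℝ)..1, F s θ := by
    have := reCLM.intervalIntegral_comp_comm hint
    simp only [reCLM_apply] at this
    rw [← this, ← hswap, ← intervalIntegral.integral_const_mul]
    refine intervalIntegral.integral_congr_ae (Filter.Eventually.of_forall fun s hs => ?_)
    rw [uIoc_of_le zero_le_one] at hs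
    exact hstep s hs
  have hKint : ∀ θ, IntervalIntegrable (fun s => K s θ) volume 0 1 := by
    intro θ
    refine ContinuousOn.intervalIntegrable ?_
    rw [uIcc_of_le zero_le_one]
    exact hKc.comp (f := fun s => (s, θ)) (by fun_prop) fun s hs => ⟨hs, mem_univ _⟩
  have hinner : ∀ θ, (c (circleMap 0 R θ)).re * m ≤ ∫ s in (0 : ℝ)..1, F s θ := by
    intro θ
    have h1 := h (circleMap 0 R θ) (mem_sphere_zero_iff_norm.1 (hmem θ))
    have h2 := reCLM.intervalIntegral_comp_comm (hKint θ)
    simp only [reCLM_apply] at h2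
    simp only [hF]
    rw [intervalIntegral.integral_const_mul, h2]
    refine mul_le_mul_of_nonneg_left h1 (hc.re_pos _ ?_).le
    exact closedBall_subset_ball hR1 (sphere_subset_closedBall (hmem θ))
  have hFi2 : IntervalIntegrable (fun θ => ∫ s in (0 : ℝ)..1, F s θ) volume 0 (2 * π) := by
    rw [intervalIntegrable_iff]
    have h1 : Integrable (Function.uncurry F)
        ((volume.restrict (uIoc 0 1)).prod (volume.restrict (uIoc 0 (2 * π)))) := by
      rw [Measure.prod_restrict]; exact hFi
    have h2 := h1.integral_prod_right
    simp only [Function.uncurry_apply_pair] at h2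
    rw [uIoc_of_le (zero_le_one (α := ℝ))] at h2
    simp only [intervalIntegral.integral_of_le (zero_le_one (α := ℝ))]
    exact h2
  have havg := hc.circleAverage_re hR hR1
  rw [circleAverage_def, smul_eq_mul] at havg
  rw [hre]
  calc m = (2 * π)⁻¹ * ∫ θ in (0 : ℝ)..2 * π, (c (circleMap 0 R θ)).re * m := by
        rw [intervalIntegral.integral_mul_const, ← mul_assoc, havg, one_mul]
    _ ≤ _ := by
        refine mul_le_mul_of_nonneg_left ?_ (by positivity)
        refine intervalIntegral.integral_mono_on two_pi_pos.le ?_ hFi2 fun θ _ => hinner θ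
        exact ((continuous_re.comp hccirc).mul continuous_const).intervalIntegrable _ _

/-! ### The extremal problem for the kernel -/

lemma integral_div_one_add_mul_sq {T : ℝ} (hT : 0 ≤ T) :
    ∫ s in (0 : ℝ)..1, 4 * T / (1 + T * s) ^ 2 = 4 * T / (1 + T) := by
  have hpos : ∀ s ∈ uIcc (0 : ℝ) 1, 0 < 1 + T * s := by
    intro s hs
    rw [uIcc_of_le zero_le_one] at hs
    nlinarith [mul_nonneg hT hs.1]
  have h := intervalIntegral.integral_eq_sub_of_hasDerivAt (a := 0) (b := 1)
    (f := fun s : ℝ => 4 * T * s / (1 + T * s)) (f' := fun s => 4 * T / (1 + T * s) ^ 2) ?_ ?_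
  · rw [h]; simp
  · intro s hs
    refine (((hasDerivAt_id' s).const_mul (4 * T)).div
      (((hasDerivAt_id' s).const_mul T).const_add 1) (hpos s hs).ne').congr_deriv ?_
    congr 1
    ring
  · refine ContinuousOn.intervalIntegrable ?_
    exact continuousOn_const.div (by fun_prop) fun s hs => (pow_pos (hpos s hs) 2).ne'

/-- The derivative along the unit circle of the primitive of `2N / (1 - Nz + T²z²)` is controlled
by the sign of the imaginary part. -/
lemma im_mul_div_one_sub_add_sq (N T : ℝ) {z : ℂ} (hz : ‖z‖ = 1) :
    (z * (2 * N / (1 - N * z + T ^ 2 * z ^ 2))).im =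
      2 * N * (1 - T ^ 2) * z.im / normSq (1 - N * z + T ^ 2 * z ^ 2) := by
  have h1 : z.re * z.re + z.im * z.im = 1 := by
    rw [← normSq_apply, normSq_eq_norm_sq, hz, one_pow]
  have h2 : (z * conj (1 - N * z + T ^ 2 * z ^ 2)) = z - N + T ^ 2 * conj z := by
    have h3 : z * conj z = 1 := by rw [mul_conj, normSq_eq_norm_sq, hz]; simp
    simp only [map_add, map_sub, map_mul, map_one, conj_ofReal, map_pow]
    linear_combination (-(N : ℂ) + T ^ 2 * conj z) * h3
  rw [← mul_div_assoc, div_eq_mul_inv, Complex.inv_def, show z * (2 * (N : ℂ)) *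
    (conj (1 - N * z + T ^ 2 * z ^ 2) * ((normSq (1 - N * z + T ^ 2 * z ^ 2))⁻¹ : ℝ)) =
    ((2 * N * (normSq (1 - N * z + T ^ 2 * z ^ 2))⁻¹ : ℝ) : ℂ) *
      (z * conj (1 - N * z + T ^ 2 * z ^ 2)) by push_cast; ring, h2, im_ofReal_mul]
  have h4 : (z - N + T ^ 2 * conj z).im = (1 - T ^ 2) * z.im := by
    rw [← ofReal_pow, add_im, sub_im, im_ofReal_mul, conj_im, ofReal_im]; ring
  rw [h4]; ring

/-- The sharp lower bound for the logarithmic kernel of a pair of extreme points. -/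
lemma neg_le_re_integral_kernel {a b : ℂ} {T : ℝ} (ha : ‖a‖ = T) (hb : ‖b‖ = T) (hT1 : T < 1) :
    -(4 * T / (1 + T)) ≤
      (∫ s in (0 : ℝ)..1, 2 * (a + b) / ((1 - s * a) * (1 - s * b))).re := by
  have hT0 : 0 ≤ T := ha ▸ norm_nonneg a
  by_cases hab : a + b = 0
  · simp only [hab, mul_zero, zero_div, intervalIntegral.integral_zero, zero_re]
    have : 0 ≤ 4 * T / (1 + T) := by positivity
    linarith
  set N : ℝ := ‖a + b‖ with hN
  have hN0 : 0 < N := norm_pos_iff.2 hab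
  -- The problem has two parameters, the direction `u` and the length `N` of `a + b`. The minimum is
  -- found over `u` first (at `u = -1`), then over `N` (at `N = 2T`, where `a = b`).
  have hNT : N ≤ 2 * T := (norm_add_le _ _).trans (by rw [ha, hb]; linarith)
  have hTpos : 0 < T := by linarith
  have hNC : (N : ℂ) ≠ 0 := by exact_mod_cast hN0.ne'
  set u : ℂ := (a + b) / N with hu
  have hu1 : ‖u‖ = 1 := by
    rw [hu, norm_div, norm_real, Real.norm_of_nonneg hN0.le, ← hN, div_self hN0.ne']
  have hu0 : u ≠ 0 := by intro h; rw [h, norm_zero] at hu1; exact zero_ne_one hu1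
  have hsum : a + b = N * u := by rw [hu]; field_simp
  -- As `|a| = |b|`, the product points in the direction of the square of the sum.
  have hprod : a * b = T ^ 2 * u ^ 2 := by
    have haa : a * conj a = T ^ 2 := by rw [mul_conj, normSq_eq_norm_sq, ha]; push_cast; rfl
    have hbb : b * conj b = T ^ 2 := by rw [mul_conj, normSq_eq_norm_sq, hb]; push_cast; rfl
    have huu : u * conj u = 1 := by rw [mul_conj, normSq_eq_norm_sq, hu1]; simp
    have hcs : conj a + conj b = N * conj u := by
      rw [← map_add, hsum, map_mul, conj_ofReal]
    have h1 : a * b * (N * conj u) = T ^ 2 * (N * u) := by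
      rw [← hcs, ← hsum]; linear_combination b * haa + a * hbb
    have h2 : (N : ℂ) * (a * b) = N * (T ^ 2 * u ^ 2) := by
      linear_combination u * h1 - N * (a * b) * huu
    exact mul_left_cancel₀ hNC h2
  set v : ℂ → ℂ := fun z => 2 * N / (1 - N * z + T ^ 2 * z ^ 2) with hv
  -- The roots of the denominator have modulus `1 / T > 1`, so `v` has a primitive on a disk
  -- containing the closed unit disk.
  have hden : ∀ z ∈ ball (0 : ℂ) (1 / T), 1 - N * z + T ^ 2 * z ^ 2 ≠ 0 := by
    intro z hz h0
    rw [mem_ball_zero_iff, lt_div_iff₀ hTpos] at hz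
    have hfac : (1 - z / u * a) * (1 - z / u * b) = 0 := by
      rw [← h0]
      have : (1 - z / u * a) * (1 - z / u * b) = 1 - z / u * (a + b) + (z / u) ^ 2 * (a * b) := by
        ring
      rw [this, hsum, hprod]
      field_simp
    have hn : ∀ x : ℂ, ‖x‖ = T → 1 - z / u * x ≠ 0 := by
      intro x hx h1
      have h2 := congrArg norm (sub_eq_zero.1 h1)
      rw [norm_mul, norm_div, hu1, div_one, hx, norm_one] at h2
      linarith
    exact mul_ne_zero (hn a ha) (hn b hb) hfac
  have hvd : DifferentiableOn ℂ v (ball 0 (1 / T)) :=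
    DifferentiableOn.div (by fun_prop) (by fun_prop) hden
  obtain ⟨V, hV⟩ := hvd.isExactOn_ball
  have h1T : 1 < 1 / T := by rw [lt_div_iff₀ hTpos]; linarith
  have hmem : ∀ z : ℂ, ‖z‖ ≤ 1 → z ∈ ball (0 : ℂ) (1 / T) := fun z hz =>
    mem_ball_zero_iff.2 (hz.trans_lt h1T)
  have hray : ∀ z : ℂ, ‖z‖ = 1 → ∫ s in (0 : ℝ)..1, z * v (s * z) = V z - V 0 := by
    intro z hz
    have hs : ∀ s ∈ uIcc (0 : ℝ) 1, ‖(s : ℂ) * z‖ ≤ 1 := by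
      intro s hs
      rw [uIcc_of_le zero_le_one] at hs
      rw [norm_mul, hz, mul_one, norm_real, Real.norm_of_nonneg hs.1]
      exact hs.2
    rw [intervalIntegral.integral_eq_sub_of_hasDerivAt (f := fun s : ℝ => V (s * z))]
    · simp
    · intro s hs'
      have h1 := hV _ (hmem _ (hs s hs'))
      have h2 : HasDerivAt (fun s : ℝ => (s : ℂ) * z) z s := by
        simpa using (ofRealCLM.hasDerivAt (x := s)).mul_const z
      simpa [mul_comm, smul_eq_mul, Function.comp_def] using h1.comp s h2
    · refine ContinuousOn.intervalIntegrable (continuousOn_const.mul ?_)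
      exact hvd.continuousOn.comp (by fun_prop) fun s hs' => hmem _ (hs s hs')
  have hderiv : ∀ θ : ℝ, HasDerivAt (fun θ : ℝ => (V (exp (θ * I))).re)
      (-(exp (θ * I) * v (exp (θ * I))).im) θ := by
    intro θ
    have h1 := hV _ (hmem (exp (θ * I)) (norm_exp_ofReal_mul_I θ).le)
    have h2 : HasDerivAt (fun θ : ℝ => exp (θ * I)) (exp (θ * I) * I) θ := by
      have h3 : HasDerivAt (fun θ : ℝ => (θ : ℂ) * I) I θ := by
        simpa using (ofRealCLM.hasDerivAt (x := θ)).mul_const I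
      exact h3.cexp
    refine ((reCLM.hasFDerivAt (x := V (exp (θ * I)))).comp_hasDerivAt θ
      (h1.comp θ h2)).congr_deriv ?_
    rw [reCLM_apply, show v (exp (θ * I)) * (exp (θ * I) * I) = (exp (θ * I) * v (exp (θ * I))) * I by ring,
      mul_I_re]
  have hdv : ∀ θ : ℝ, -(exp (θ * I) * v (exp (θ * I))).im =
      -(2 * N * (1 - T ^ 2) * Real.sin θ /
        normSq (1 - N * exp (θ * I) + T ^ 2 * exp (θ * I) ^ 2)) := by
    intro θ
    rw [hv, im_mul_div_one_sub_add_sq N T (norm_exp_ofReal_mul_I θ), exp_ofReal_mul_I_im]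
  have hcoef : 0 ≤ 2 * N * (1 - T ^ 2) := by
    have : T ^ 2 ≤ 1 := by nlinarith
    have := sub_nonneg.2 this
    positivity
  have hcont : Continuous fun θ : ℝ => (V (exp (θ * I))).re :=
    continuous_iff_continuousAt.2 fun θ => (hderiv θ).continuousAt
  -- The derivative of `θ ↦ Re V(e^{iθ})` has the sign of `-sin θ`, so it falls from `θ = 0` to `±π`
  -- on both sides.
  have hmin : (V (-1)).re ≤ (V u).re := by
    have hue : u = exp (arg u * I) := by
      have := norm_mul_exp_arg_mul_I u
      rw [hu1] at this
      simpa using this.symm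
    rw [hue]
    rcases le_total 0 (arg u) with h0 | h0
    · have hanti : AntitoneOn (fun θ : ℝ => (V (exp (θ * I))).re) (Icc 0 π) := by
        refine antitoneOn_of_deriv_nonpos (convex_Icc _ _) hcont.continuousOn
          (fun θ _ => (hderiv θ).differentiableAt.differentiableWithinAt) fun θ hθ => ?_
        rw [interior_Icc] at hθ
        rw [(hderiv θ).deriv, hdv, neg_nonpos]
        exact div_nonneg (mul_nonneg hcoef (sin_nonneg_of_nonneg_of_le_pi hθ.1.le hθ.2.le))
          (normSq_nonneg _)
      have := hanti ⟨h0, arg_le_pi u⟩ (right_mem_Icc.2 pi_pos.le) (arg_le_pi u)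
      simpa [exp_pi_mul_I] using this
    · have hmono : MonotoneOn (fun θ : ℝ => (V (exp (θ * I))).re) (Icc (-π) 0) := by
        refine monotoneOn_of_deriv_nonneg (convex_Icc _ _) hcont.continuousOn
          (fun θ _ => (hderiv θ).differentiableAt.differentiableWithinAt) fun θ hθ => ?_
        rw [interior_Icc] at hθ
        rw [(hderiv θ).deriv, hdv, neg_nonneg]
        exact div_nonpos_of_nonpos_of_nonneg
          (mul_nonpos_of_nonneg_of_nonpos hcoef (sin_nonpos_of_nonpos_of_neg_pi_le hθ.2.le hθ.1.le))
          (normSq_nonneg _)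
      have := hmono (left_mem_Icc.2 (by linarith [pi_pos])) ⟨(neg_pi_lt_arg u).le, h0⟩
        (neg_pi_lt_arg u).le
      simpa [Complex.exp_neg, exp_pi_mul_I] using this
  have hint : ∫ s in (0 : ℝ)..1, 2 * (a + b) / ((1 - s * a) * (1 - s * b)) = V u - V 0 := by
    rw [← hray u hu1]
    refine intervalIntegral.integral_congr fun s _ => ?_
    simp only [hv]
    rw [show (1 - s * a) * (1 - s * b) = 1 - s * (a + b) + s ^ 2 * (a * b) by ring, hsum, hprod,
      ← mul_div_assoc]
    ring
  have hneg : -(4 * T / (1 + T)) ≤ (V (-1) - V 0).re := by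
    have hpos : ∀ s ∈ Icc (0 : ℝ) 1, 0 < 1 + N * s + T ^ 2 * s ^ 2 := by
      intro s hs
      have := mul_nonneg hN0.le hs.1
      positivity
    have heq : V (-1) - V 0 =
        ((∫ s in (0 : ℝ)..1, -(2 * N / (1 + N * s + T ^ 2 * s ^ 2)) : ℝ) : ℂ) := by
      rw [← hray (-1) (by simp), ← intervalIntegral.integral_ofReal]
      refine intervalIntegral.integral_congr fun s _ => ?_
      simp only [hv]
      push_cast
      rw [neg_one_mul]
      congr 2
      ring
    rw [heq, ofReal_re, intervalIntegral.integral_neg, neg_le_neg_iff,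
      ← integral_div_one_add_mul_sq hT0]
    refine intervalIntegral.integral_mono_on zero_le_one ?_ ?_ fun s hs => ?_
    · refine ContinuousOn.intervalIntegrable ?_
      rw [uIcc_of_le zero_le_one]
      exact continuousOn_const.div (by fun_prop) fun s hs => (hpos s hs).ne'
    · refine ContinuousOn.intervalIntegrable ?_
      rw [uIcc_of_le zero_le_one]
      refine continuousOn_const.div (by fun_prop) fun s hs => ?_
      have := mul_nonneg hT0 hs.1
      positivity
    · have h1 := mul_nonneg hT0 hs.1
      rw [div_le_div_iff₀ (hpos s hs) (by positivity)]
      -- `2N / (1 + N s + T² s²)` increases with `N`, and at `N = 2T` its denominator is `(1 + T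
      -- s)²`. The cross-multiplied difference is a multiple of `(2T - N)(1 + T² s²)`.
      nlinarith [mul_nonneg (sub_nonneg.2 hNT) (show 0 ≤ 1 + T ^ 2 * s ^ 2 by positivity)]
  rw [hint]
  rw [sub_re] at hneg ⊢
  linarith

/-! ### Radial integrals of difference quotients -/

section RadialIntegral

variable {F : ℂ → ℂ} {w : ℂ}

lemma norm_ofReal_mul_lt_one (hw : ‖w‖ < 1) {s : ℝ} (hs : s ∈ Icc (0 : ℝ) 1) :
    ‖(s : ℂ) * w‖ < 1 := by
  rw [norm_mul, norm_real, Real.norm_of_nonneg hs.1]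
  nlinarith [hs.2, norm_nonneg w]

lemma ContinuousOn.comp_ofReal_mul (hF : ContinuousOn F (ball 0 1)) (hw : ‖w‖ < 1) :
    ContinuousOn (fun s : ℝ => F (s * w)) (Icc 0 1) :=
  hF.comp (by fun_prop) fun _ hs => mem_ball_zero_iff.2 (norm_ofReal_mul_lt_one hw hs)

lemma DifferentiableOn.continuousOn_dslope (hF : DifferentiableOn ℂ F (ball 0 1)) :
    ContinuousOn (dslope F 0) (ball 0 1) :=
  ((Complex.differentiableOn_dslope (ball_mem_nhds 0 one_pos)).2 hF).continuousOn

lemma intervalIntegrable_mul_dslope (hF : DifferentiableOn ℂ F (ball 0 1)) (hw : ‖w‖ < 1) :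
    IntervalIntegrable (fun s : ℝ => w * dslope F 0 (s * w)) volume 0 1 := by
  refine ContinuousOn.intervalIntegrable ?_
  rw [uIcc_of_le zero_le_one]
  exact continuousOn_const.mul (hF.continuousOn_dslope.comp_ofReal_mul hw)

/-- `dslope` stands for `(F(sw) - F 0) / (sw)` without a singularity at `s = 0`; multiplying by `s`
recovers the increment of `F`, which is how the later identities between integrands are checked. -/
lemma ofReal_mul_mul_dslope (F : ℂ → ℂ) (w : ℂ) (s : ℝ) :
    s * (w * dslope F 0 (s * w)) = F (s * w) - F 0 := by
  have := sub_smul_dslope F 0 (s * w)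
  rw [sub_zero, smul_eq_mul] at this
  rw [← this]; ring

lemma integral_congr_Ioc {f g : ℝ → ℂ} (h : ∀ s ∈ Ioc (0 : ℝ) 1, f s = g s) :
    ∫ s in (0 : ℝ)..1, f s = ∫ s in (0 : ℝ)..1, g s := by
  refine intervalIntegral.integral_congr_ae (Filter.Eventually.of_forall fun s hs => ?_)
  rw [uIoc_of_le zero_le_one] at hs
  exact h s hs

/-- A function vanishing at the origin as a radial integral of its derivative. -/
lemma integral_mul_dslope_eq {E : ℂ → ℂ} (hE : DifferentiableOn ℂ E (ball 0 1)) (hE0 : E 0 = 0)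
    (hEF : ∀ z ∈ ball (0 : ℂ) 1, z * deriv E z = F z - F 0) (hw : ‖w‖ < 1) :
    ∫ s in (0 : ℝ)..1, w * dslope F 0 (s * w) = E w := by
  have h1 : ∫ s in (0 : ℝ)..1, w * deriv E (s * w) = E w := by
    rw [intervalIntegral.integral_eq_sub_of_hasDerivAt (f := fun s : ℝ => E (s * w))]
    · simp [hE0]
    · intro s hs
      rw [uIcc_of_le zero_le_one] at hs
      have h1 := (hE.differentiableAt (isOpen_ball.mem_nhds
        (mem_ball_zero_iff.2 (norm_ofReal_mul_lt_one hw hs)))).hasDerivAt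
      have h2 : HasDerivAt (fun s : ℝ => (s : ℂ) * w) w s := by
        simpa using (ofRealCLM.hasDerivAt (x := s)).mul_const w
      exact (h1.comp s h2).congr_deriv (mul_comm _ _)
    · refine ContinuousOn.intervalIntegrable ?_
      rw [uIcc_of_le zero_le_one]
      exact continuousOn_const.mul
        ((hE.deriv isOpen_ball).continuousOn.comp_ofReal_mul hw)
  rw [← h1]
  refine integral_congr_Ioc fun s hs => ?_
  have hs0 : (s : ℂ) ≠ 0 := by exact_mod_cast hs.1.ne'
  apply mul_left_cancel₀ hs0
  rw [ofReal_mul_mul_dslope, ← hEF _ (mem_ball_zero_iff.2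
    (norm_ofReal_mul_lt_one hw (Ioc_subset_Icc_self hs)))]
  ring

lemma re_integral_mul_dslope (hF : DifferentiableOn ℂ F (ball 0 1)) (hw : ‖w‖ < 1) :
    (∫ s in (0 : ℝ)..1, w * dslope F 0 (s * w)).re =
      ∫ s in (0 : ℝ)..1, (w * dslope F 0 (s * w)).re := by
  have := reCLM.intervalIntegral_comp_comm (intervalIntegrable_mul_dslope hF hw)
  simpa using this.symm

lemma mul_re_mul_dslope (F : ℂ → ℂ) (w : ℂ) (s : ℝ) :
    s * (w * dslope F 0 (s * w)).re = (F (s * w) - F 0).re := by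
  rw [← re_ofReal_mul, ofReal_mul_mul_dslope]

variable {U U' : ℝ → ℝ}

lemma re_integral_mul_dslope_le (hF : DifferentiableOn ℂ F (ball 0 1)) (hw : ‖w‖ < 1)
    (hU : ∀ s ∈ Icc (0 : ℝ) 1, HasDerivAt U (U' s) s) (hU' : ContinuousOn U' (Icc 0 1))
    (hle : ∀ s ∈ Ioo (0 : ℝ) 1, (F (s * w) - F 0).re ≤ s * U' s) :
    (∫ s in (0 : ℝ)..1, w * dslope F 0 (s * w)).re ≤ U 1 - U 0 := by
  rw [← uIcc_of_le zero_le_one] at hU hU'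
  have hi : IntervalIntegrable U' volume 0 1 := hU'.intervalIntegrable
  rw [re_integral_mul_dslope hF hw, ← intervalIntegral.integral_eq_sub_of_hasDerivAt hU hi]
  refine intervalIntegral.integral_mono_on_of_le_Ioo zero_le_one
    (intervalIntegrable_iff.2 (reCLM.integrable_comp
      (intervalIntegrable_iff.1 (intervalIntegrable_mul_dslope hF hw)))) hi fun s hs => ?_
  have := hle s hs
  rw [← mul_re_mul_dslope] at this
  exact le_of_mul_le_mul_left this hs.1

lemma le_re_integral_mul_dslope (hF : DifferentiableOn ℂ F (ball 0 1)) (hw : ‖w‖ < 1)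
    (hU : ∀ s ∈ Icc (0 : ℝ) 1, HasDerivAt U (U' s) s) (hU' : ContinuousOn U' (Icc 0 1))
    (hle : ∀ s ∈ Ioo (0 : ℝ) 1, s * U' s ≤ (F (s * w) - F 0).re) :
    U 1 - U 0 ≤ (∫ s in (0 : ℝ)..1, w * dslope F 0 (s * w)).re := by
  rw [← uIcc_of_le zero_le_one] at hU hU'
  have hi : IntervalIntegrable U' volume 0 1 := hU'.intervalIntegrable
  rw [re_integral_mul_dslope hF hw, ← intervalIntegral.integral_eq_sub_of_hasDerivAt hU hi]
  refine intervalIntegral.integral_mono_on_of_le_Ioo zero_le_one hi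
    (intervalIntegrable_iff.2 (reCLM.integrable_comp
      (intervalIntegrable_iff.1 (intervalIntegrable_mul_dslope hF hw)))) fun s hs => ?_
  have := hle s hs
  rw [← mul_re_mul_dslope] at this
  exact le_of_mul_le_mul_left this hs.1

end RadialIntegral

/-! ### The sharp radial bound for a product of two Carathéodory functions -/

namespace IsCaratheodory

variable {p q : ℂ → ℂ} {w : ℂ}

/-- The functions need not extend to the unit circle, so the representation is used on `|ζ| = R <
1`. Since `pq - 1 = q (p - 1) + (q - 1)`, the integral is affine in each factor: `q` is replaced by
its representation while `p` is an extreme point, and then `p` by its own. -/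
lemma neg_le_re_integral_mul_aux (hp : IsCaratheodory p) (hq : IsCaratheodory q) {R : ℝ}
    (hR1 : R < 1) (hw0 : w ≠ 0) (hw : ‖w‖ < R) :
    -(4 * ‖w‖ / (R + ‖w‖)) ≤
      (∫ s in (0 : ℝ)..1, w * dslope (fun z => p z * q z) 0 (s * w)).re := by
  have hR : 0 < R := (norm_nonneg w).trans_lt hw
  have hw1 : ‖w‖ < 1 := hw.trans hR1
  have hne : ∀ s ∈ Icc (0 : ℝ) 1, ∀ ζ : ℂ, ‖ζ‖ = R → ζ - s * w ≠ 0 := by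
    intro s hs ζ hζ h0
    have h1 := congrArg norm (sub_eq_zero.1 h0)
    rw [hζ, norm_mul, norm_real, Real.norm_of_nonneg hs.1] at h1
    nlinarith [hs.2, norm_nonneg w]
  have hkc : ∀ ζ : ℂ, ‖ζ‖ = R → ContinuousOn (fun s : ℝ => 2 * w / (ζ - s * w)) (Icc 0 1) :=
    fun ζ hζ => continuousOn_const.div (by fun_prop) fun s hs => hne s hs ζ hζ
  have hgc : ∀ ζ : ℂ, ‖ζ‖ = R →
      ContinuousOn (fun s : ℝ => (ζ + s * w) / (ζ - s * w)) (Icc 0 1) :=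
    fun ζ hζ => ContinuousOn.div (by fun_prop) (by fun_prop) fun s hs => hne s hs ζ hζ
  have hint : ∀ {f : ℝ → ℂ}, ContinuousOn f (Icc 0 1) → IntervalIntegrable f volume 0 1 :=
    fun h => ContinuousOn.intervalIntegrable (by rwa [uIcc_of_le zero_le_one])
  have hintm : ∀ {f g : ℝ → ℂ}, ContinuousOn f (Icc 0 1) → ContinuousOn g (Icc 0 1) →
      IntervalIntegrable (fun s => f s * g s) volume 0 1 := fun hf hg => hint (hf.mul hg)
  have hqc : ContinuousOn (fun s : ℝ => q (s * w)) (Icc 0 1) :=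
    hq.differentiableOn.continuousOn.comp_ofReal_mul hw1
  have hdc : ContinuousOn (fun s : ℝ => w * dslope q 0 (s * w)) (Icc 0 1) :=
    continuousOn_const.mul (hq.differentiableOn.continuousOn_dslope.comp_ofReal_mul hw1)
  have hdpc : ContinuousOn (fun s : ℝ => w * dslope p 0 (s * w)) (Icc 0 1) :=
    continuousOn_const.mul (hp.differentiableOn.continuousOn_dslope.comp_ofReal_mul hw1)
  -- Both factors are extreme points here; with `a = w / ζ` and `b = w / η` the combined integrand
  -- is `2 (a + b) / ((1 - s a)(1 - s b))`.
  have hker : ∀ ζ η : ℂ, ‖ζ‖ = R → ‖η‖ = R → -(4 * ‖w‖ / (R + ‖w‖)) ≤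
      (∫ s in (0 : ℝ)..1, (ζ + s * w) / (ζ - s * w) * (2 * w / (η - s * w))).re +
        (∫ s in (0 : ℝ)..1, 2 * w / (ζ - s * w)).re := by
    intro ζ η hζ hη
    have hζ0 : ζ ≠ 0 := norm_pos_iff.1 (hζ ▸ hR)
    have hη0 : η ≠ 0 := norm_pos_iff.1 (hη ▸ hR)
    have h := neg_le_re_integral_kernel (a := w / ζ) (b := w / η) (T := ‖w‖ / R)
      (by rw [norm_div, hζ]) (by rw [norm_div, hη]) ((div_lt_one hR).2 hw)
    rw [show 4 * (‖w‖ / R) / (1 + ‖w‖ / R) = 4 * ‖w‖ / (R + ‖w‖) by field_simp] at h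
    refine h.trans_eq ?_
    rw [← add_re, ← intervalIntegral.integral_add (hintm (hgc ζ hζ) (hkc η hη))
      (hint (hkc ζ hζ))]
    congr 1
    refine integral_congr_Ioc fun s hs => ?_
    have h1 := hne s (Ioc_subset_Icc_self hs) ζ hζ
    have h2 := hne s (Ioc_subset_Icc_self hs) η hη
    have h3 : 1 - s * (w / ζ) = (ζ - s * w) / ζ := by field_simp
    have h4 : 1 - s * (w / η) = (η - s * w) / η := by field_simp
    rw [h3, h4]
    set X := ζ - s * w
    set Y := η - s * w with hY
    field_simp
    rw [hY]
    ring
  have hstep : ∀ ζ : ℂ, ‖ζ‖ = R →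
      -(4 * ‖w‖ / (R + ‖w‖)) - (∫ s in (0 : ℝ)..1, w * dslope q 0 (s * w)).re ≤
        (∫ s in (0 : ℝ)..1, q (s * w) * (2 * w / (ζ - s * w))).re := by
    intro ζ hζ
    have h := hq.le_re_integral_weight_mul_dslope hR1 hw0 hw (hgc ζ hζ)
      (m := -(4 * ‖w‖ / (R + ‖w‖)) - (∫ s in (0 : ℝ)..1, 2 * w / (ζ - s * w)).re)
      fun η hη => by linarith [hker ζ η hζ hη]
    -- For the extreme point `p` at `ζ`, these are the two ways of splitting `pq - 1`: `q (p - 1) +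
    -- (q - 1)` and `p (q - 1) + (p - 1)`. The first suits the final use of `p`, the second the
    -- representation of `q`.
    have e : (∫ s in (0 : ℝ)..1, q (s * w) * (2 * w / (ζ - s * w))) +
        (∫ s in (0 : ℝ)..1, w * dslope q 0 (s * w)) =
        (∫ s in (0 : ℝ)..1, (ζ + s * w) / (ζ - s * w) * (w * dslope q 0 (s * w))) +
        (∫ s in (0 : ℝ)..1, 2 * w / (ζ - s * w)) := by
      rw [← intervalIntegral.integral_add (hintm hqc (hkc ζ hζ)) (hint hdc),
        ← intervalIntegral.integral_add (hintm (hgc ζ hζ) hdc) (hint (hkc ζ hζ))]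
      refine integral_congr_Ioc fun s hs => ?_
      have h1 := hne s (Ioc_subset_Icc_self hs) ζ hζ
      have h2 : q (s * w) = 1 + s * (w * dslope q 0 (s * w)) := by
        rw [ofReal_mul_mul_dslope, hq.map_zero]; ring
      rw [h2]
      field_simp
      ring
    have e' := congrArg Complex.re e
    rw [add_re, add_re] at e'
    linarith
  have h := hp.le_re_integral_weight_mul_dslope hR1 hw0 hw hqc hstep
  have e : ∫ s in (0 : ℝ)..1, w * dslope (fun z => p z * q z) 0 (s * w) =
      (∫ s in (0 : ℝ)..1, q (s * w) * (w * dslope p 0 (s * w))) +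
        ∫ s in (0 : ℝ)..1, w * dslope q 0 (s * w) := by
    rw [← intervalIntegral.integral_add (hintm hqc hdpc) (hint hdc)]
    refine integral_congr_Ioc fun s hs => ?_
    have hs0 : (s : ℂ) ≠ 0 := by exact_mod_cast hs.1.ne'
    apply mul_left_cancel₀ hs0
    have h1 := ofReal_mul_mul_dslope p w s
    have h2 := ofReal_mul_mul_dslope q w s
    rw [ofReal_mul_mul_dslope]
    rw [hp.map_zero] at *
    rw [hq.map_zero] at *
    linear_combination -q (s * w) * h1 - h2
  rw [e, add_re]
  linarith

/-- The sharp lower bound for the radial integral of a product of two Carathéodory functions. -/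
theorem neg_le_re_integral_mul (hp : IsCaratheodory p) (hq : IsCaratheodory q) (hw : ‖w‖ < 1) :
    -(4 * ‖w‖ / (1 + ‖w‖)) ≤
      (∫ s in (0 : ℝ)..1, w * dslope (fun z => p z * q z) 0 (s * w)).re := by
  rcases eq_or_ne w 0 with rfl | hw0
  · simp
  have hlim : Filter.Tendsto (fun R : ℝ => -(4 * ‖w‖ / (R + ‖w‖))) (nhdsWithin 1 (Iio 1))
      (nhds (-(4 * ‖w‖ / (1 + ‖w‖)))) := by
    have hc : ContinuousAt (fun R : ℝ => -(4 * ‖w‖ / (R + ‖w‖))) 1 :=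
      (continuousAt_const.div (by fun_prop) (by positivity)).neg
    exact hc.tendsto.mono_left nhdsWithin_le_nhds
  refine le_of_tendsto hlim ?_
  filter_upwards [Ioo_mem_nhdsLT hw] with R hR
  exact neg_le_re_integral_mul_aux hp hq hR.2 hw0 hR.1

/-- For a single function the pointwise bound on the real part is enough: `(1 - st) / (1 + st) - 1 =
-2st / (1 + st)`, which integrates to a logarithm. -/
lemma neg_log_le_re_integral (hq : IsCaratheodory q) (hw : ‖w‖ < 1) :
    -(2 * Real.log (1 + ‖w‖)) ≤ (∫ s in (0 : ℝ)..1, w * dslope q 0 (s * w)).re := by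
  have hpos : ∀ s ∈ Icc (0 : ℝ) 1, 0 < 1 + s * ‖w‖ := fun s hs => by
    have := mul_nonneg hs.1 (norm_nonneg w)
    positivity
  have h := le_re_integral_mul_dslope (U := fun s => -(2 * Real.log (1 + s * ‖w‖)))
    (U' := fun s => -(2 * (‖w‖ / (1 + s * ‖w‖)))) hq.differentiableOn hw ?_ ?_ ?_
  · simpa using h
  · intro s hs
    have h1 : HasDerivAt (fun s : ℝ => 1 + s * ‖w‖) ‖w‖ s := by
      simpa using ((hasDerivAt_id' s).mul_const ‖w‖).const_add 1
    exact ((h1.log (hpos s hs).ne').const_mul 2).neg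
  · exact (continuousOn_const.mul (continuousOn_const.div (by fun_prop)
      fun s hs => (hpos s hs).ne')).neg
  · intro s hs
    have hs' := Ioo_subset_Icc_self hs
    have h1 := hq.le_re (norm_ofReal_mul_lt_one hw hs')
    have h2 := hpos s hs'
    rw [norm_mul, norm_real, Real.norm_of_nonneg hs'.1] at h1
    rw [hq.map_zero, sub_re, one_re]
    refine le_trans (le_of_eq ?_) (sub_le_sub_right h1 1)
    field_simp
    ring

end IsCaratheodory

/-! ### Functions of order `α` and the growth of the primitive -/

namespace IsCaratheodory

variable {p q : ℂ → ℂ} {w : ℂ} {α : ℝ}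

lemma differentiableOn_order (hp : IsCaratheodory p) (α : ℝ) :
    DifferentiableOn ℂ (fun z => α + (1 - α) * p z) (ball 0 1) :=
  (hp.differentiableOn.const_mul _).const_add _

lemma norm_order_le (hp : IsCaratheodory p) (hα₀ : 0 ≤ α) (hα₁ : α < 1) (hw : ‖w‖ < 1) :
    ‖α + (1 - α) * p w‖ ≤ (1 + (1 - 2 * α) * ‖w‖) / (1 - ‖w‖) := by
  have h1 : ‖(α : ℂ)‖ = α := by rw [norm_real, Real.norm_of_nonneg hα₀]
  have h2 : ‖(1 - α : ℂ)‖ = 1 - α := by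
    rw [← ofReal_one, ← ofReal_sub, norm_real, Real.norm_of_nonneg (by linarith)]
  calc ‖α + (1 - α) * p w‖ ≤ α + (1 - α) * ‖p w‖ := by
        refine (norm_add_le _ _).trans ?_
        rw [norm_mul, h1, h2]
    _ ≤ α + (1 - α) * ((1 + ‖w‖) / (1 - ‖w‖)) := by
        have := mul_le_mul_of_nonneg_left (hp.norm_le hw) (sub_nonneg.2 hα₁.le)
        linarith
    _ = _ := by
        have : 1 - ‖w‖ ≠ 0 := by linarith
        field_simp
        ring

lemma le_norm_order (hp : IsCaratheodory p) (hα₁ : α < 1) (hw : ‖w‖ < 1) :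
    (1 - (1 - 2 * α) * ‖w‖) / (1 + ‖w‖) ≤ ‖α + (1 - α) * p w‖ := by
  have h1 := hp.le_re hw
  have h2 : (α + (1 - α) * p w : ℂ).re = α + (1 - α) * (p w).re := by
    rw [← ofReal_one, ← ofReal_sub, add_re, re_ofReal_mul, ofReal_re]
  calc (1 - (1 - 2 * α) * ‖w‖) / (1 + ‖w‖) = α + (1 - α) * ((1 - ‖w‖) / (1 + ‖w‖)) := by
        field_simp
        ring
    _ ≤ α + (1 - α) * (p w).re := by
        have := mul_le_mul_of_nonneg_left h1 (sub_nonneg.2 hα₁.le)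
        linarith
    _ = _ := h2.symm
    _ ≤ _ := re_le_norm _

variable {E : ℂ → ℂ}

/-- Here `Re ≤ |·|` loses nothing, since the bounds on both factors are attained together on a
common ray. The comparison function satisfies `s U' = (1 + (1 - 2α) st)(1 + st) / (1 - st)² - 1`. -/
lemma re_primitive_le (hp : IsCaratheodory p) (hq : IsCaratheodory q) (hα₀ : 0 ≤ α) (hα₁ : α < 1)
    (hE : DifferentiableOn ℂ E (ball 0 1)) (hE0 : E 0 = 0)
    (hEd : ∀ z ∈ ball (0 : ℂ) 1, z * deriv E z = (α + (1 - α) * p z) * q z - 1) (hw : ‖w‖ < 1) :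
    (E w).re ≤ 4 * (1 - α) * ‖w‖ / (1 - ‖w‖) - 2 * α * Real.log (1 - ‖w‖) := by
  set F : ℂ → ℂ := fun z => (α + (1 - α) * p z) * q z with hF
  have hFd : DifferentiableOn ℂ F (ball 0 1) :=
    (hp.differentiableOn_order α).mul hq.differentiableOn
  have hF0 : F 0 = 1 := by simp [hF, hp.map_zero, hq.map_zero]
  rw [← integral_mul_dslope_eq (F := F) hE hE0 (fun z hz => by rw [hEd z hz, hF0]) hw]
  set t := ‖w‖ with ht
  have ht0 : 0 ≤ t := norm_nonneg w
  have hpos : ∀ s ∈ Icc (0 : ℝ) 1, 0 < 1 - s * t := fun s hs => by nlinarith [hs.2]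
  have h := re_integral_mul_dslope_le
    (U := fun s => 4 * (1 - α) * (s * t / (1 - s * t)) - 2 * α * Real.log (1 - s * t))
    (U' := fun s => t * (4 - 2 * α - 2 * α * (s * t)) / (1 - s * t) ^ 2) hFd hw ?_ ?_ ?_
  · simpa [mul_div_assoc] using h
  · intro s hs
    have h0 : HasDerivAt (fun s : ℝ => s * t) t s := by
      simpa using (hasDerivAt_id' s).mul_const t
    have h1 : HasDerivAt (fun s : ℝ => 1 - s * t) (-t) s := by
      simpa using h0.const_sub 1
    refine (((h0.div h1 (hpos s hs).ne').const_mul _).sub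
      ((h1.log (hpos s hs).ne').const_mul _)).congr_deriv ?_
    have := (hpos s hs).ne'
    field_simp
    ring
  · exact ContinuousOn.div (by fun_prop) (by fun_prop) fun s hs => (pow_pos (hpos s hs) 2).ne'
  · intro s hs
    have hs' := Ioo_subset_Icc_self hs
    have hsw := norm_ofReal_mul_lt_one hw hs'
    have h1 := hp.norm_order_le hα₀ hα₁ hsw
    have h2 := hq.norm_le hsw
    have h3 := hpos s hs'
    have hn : ‖(s : ℂ) * w‖ = s * t := by
      rw [norm_mul, norm_real, Real.norm_of_nonneg hs'.1]
    rw [hn] at h1 h2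
    rw [hF0, sub_re, one_re]
    calc (F (s * w)).re - 1 ≤ ‖F (s * w)‖ - 1 := by gcongr; exact re_le_norm _
      _ ≤ (1 + (1 - 2 * α) * (s * t)) / (1 - s * t) * ((1 + s * t) / (1 - s * t)) - 1 := by
        rw [hF, norm_mul]
        gcongr
        exact (norm_nonneg _).trans h1
      _ = _ := by
        field_simp
        ring

/-- Write `P q = (1 - α) p q + α q`: the first term needs the integrated product bound and yields
the rational term, the second yields the logarithm. -/
lemma le_re_primitive (hp : IsCaratheodory p) (hq : IsCaratheodory q) (hα₀ : 0 ≤ α) (hα₁ : α < 1)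
    (hE : DifferentiableOn ℂ E (ball 0 1)) (hE0 : E 0 = 0)
    (hEd : ∀ z ∈ ball (0 : ℂ) 1, z * deriv E z = (α + (1 - α) * p z) * q z - 1) (hw : ‖w‖ < 1) :
    -(4 * (1 - α) * ‖w‖ / (1 + ‖w‖)) - 2 * α * Real.log (1 + ‖w‖) ≤ (E w).re := by
  have hF0 : (α + (1 - α) * p 0) * q 0 = 1 := by simp [hp.map_zero, hq.map_zero]
  have hpq : DifferentiableOn ℂ (fun z => p z * q z) (ball 0 1) :=
    hp.differentiableOn.mul hq.differentiableOn
  have e : E w = ((1 - α : ℝ) : ℂ) *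
      (∫ s in (0 : ℝ)..1, w * dslope (fun z => p z * q z) 0 (s * w)) +
      (α : ℂ) * ∫ s in (0 : ℝ)..1, w * dslope q 0 (s * w) := by
    rw [← integral_mul_dslope_eq (F := fun z => (α + (1 - α) * p z) * q z) hE hE0
      (fun z hz => by rw [hEd z hz, hF0]) hw, ← intervalIntegral.integral_const_mul,
      ← intervalIntegral.integral_const_mul, ← intervalIntegral.integral_add
        ((intervalIntegrable_mul_dslope hpq hw).const_mul _)
        ((intervalIntegrable_mul_dslope hq.differentiableOn hw).const_mul _)]
    refine integral_congr_Ioc fun s hs => ?_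
    have hs0 : (s : ℂ) ≠ 0 := by exact_mod_cast hs.1.ne'
    apply mul_left_cancel₀ hs0
    have h1 := ofReal_mul_mul_dslope (fun z => p z * q z) w s
    have h2 := ofReal_mul_mul_dslope q w s
    rw [ofReal_mul_mul_dslope, hF0]
    simp only [hp.map_zero, hq.map_zero] at h1 h2
    push_cast
    linear_combination -(1 - α : ℂ) * h1 - α * h2
  have h1 := mul_le_mul_of_nonneg_left (hp.neg_le_re_integral_mul hq hw) (sub_nonneg.2 hα₁.le)
  have h2 := mul_le_mul_of_nonneg_left (hq.neg_log_le_re_integral hw) hα₀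
  rw [e, add_re, re_ofReal_mul, re_ofReal_mul]
  calc _ = (1 - α) * -(4 * ‖w‖ / (1 + ‖w‖)) + α * -(2 * Real.log (1 + ‖w‖)) := by ring
    _ ≤ _ := add_le_add h1 h2

end IsCaratheodory

/-! ### From the dilatation to a Carathéodory pair; distortion bounds -/

/-- Turns the dilatation bound `|G| < |H|` into positivity of the real part of `(H + G) / (H - G)`.
-/
lemma re_add_div_sub (x y : ℂ) :
    ((x + y) / (x - y)).re = (‖x‖ ^ 2 - ‖y‖ ^ 2) / ‖x - y‖ ^ 2 := by
  rw [div_re, ← normSq_eq_norm_sq, ← normSq_eq_norm_sq, ← normSq_eq_norm_sq, normSq_apply x,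
    normSq_apply y, add_re, add_im, sub_re, sub_im]
  ring

/-- If the difference of the logarithmic derivatives `H` and `G` has real part greater than `α` and
`G = ω H` with `‖ω‖ < 1`, then `H - G = P` and `H + G = P q` with `P` of order `α` and `q` a
Carathéodory function. -/
lemma exists_isCaratheodory_of_dilatation {H G : ℂ → ℂ} {α : ℝ} (hα₀ : 0 ≤ α) (hα₁ : α < 1)
    (hH : DifferentiableOn ℂ H (ball 0 1)) (hG : DifferentiableOn ℂ G (ball 0 1))
    (hH0 : H 0 = 1) (hG0 : G 0 = 0)
    (hre : ∀ z ∈ ball (0 : ℂ) 1, z ≠ 0 → α < (H z - G z).re)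
    (hω : ∀ z ∈ ball (0 : ℂ) 1, z ≠ 0 → ∃ ω : ℂ, ‖ω‖ < 1 ∧ G z = ω * H z) :
    ∃ p q : ℂ → ℂ, IsCaratheodory p ∧ IsCaratheodory q ∧
      ∀ z ∈ ball (0 : ℂ) 1, H z - G z = α + (1 - α) * p z ∧
        H z + G z = (α + (1 - α) * p z) * q z := by
  have h1α : (1 - α : ℂ) ≠ 0 := by
    rw [← ofReal_one, ← ofReal_sub]; exact_mod_cast (sub_pos.2 hα₁).ne'
  have hre' : ∀ z ∈ ball (0 : ℂ) 1, α < (H z - G z).re := by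
    intro z hz
    rcases eq_or_ne z 0 with rfl | h
    · simpa [hH0, hG0] using hα₁
    · exact hre z hz h
  have hP : ∀ z ∈ ball (0 : ℂ) 1, H z - G z ≠ 0 := by
    intro z hz h
    have := hre' z hz
    rw [h, zero_re] at this
    linarith
  refine ⟨fun z => (H z - G z - α) / (1 - α), fun z => (H z + G z) / (H z - G z),
    ⟨((hH.sub hG).sub_const _).div_const _, ?_, ?_⟩, ⟨(hH.add hG).div (hH.sub hG) hP, ?_, ?_⟩, ?_⟩
  · simp [hH0, hG0, h1α]
  · intro z hz
    rw [← ofReal_one, ← ofReal_sub, div_ofReal_re, sub_re, ofReal_re]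
    exact div_pos (sub_pos.2 (hre' z hz)) (sub_pos.2 hα₁)
  · simp [hH0, hG0]
  · intro z hz
    rw [re_add_div_sub]
    refine div_pos ?_ (pow_pos (norm_pos_iff.2 (hP z hz)) 2)
    rcases eq_or_ne z 0 with rfl | h
    · simp [hH0, hG0]
    · obtain ⟨ω, hω1, hGω⟩ := hω z hz h
      have hHz : H z ≠ 0 := by
        intro h0
        exact hP z hz (by rw [hGω, h0]; simp)
      rw [sub_pos]
      refine pow_lt_pow_left₀ ?_ (norm_nonneg _) two_ne_zero
      rw [hGω, norm_mul]
      exact mul_lt_of_lt_one_left (norm_pos_iff.2 hHz) hω1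
  · intro z hz
    have e : (α : ℂ) + (1 - α) * ((H z - G z - α) / (1 - α)) = H z - G z := by
      field_simp
      ring
    refine ⟨e.symm, ?_⟩
    rw [e, mul_div_cancel₀ _ (hP z hz)]

section Distortion

variable {p q : ℂ → ℂ} {α : ℝ} {w x y : ℂ}

lemma norm_le_of_sub_add (hp : IsCaratheodory p) (hq : IsCaratheodory q) (hα₀ : 0 ≤ α)
    (hα₁ : α < 1) (hw : ‖w‖ < 1) (h1 : x - y = α + (1 - α) * p w)
    (h2 : x + y = (α + (1 - α) * p w) * q w) :
    ‖y‖ ≤ ‖w‖ * ((1 + (1 - 2 * α) * ‖w‖) / (1 - ‖w‖) ^ 2) := by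
  have hy : y = (α + (1 - α) * p w) * (q w - 1) / 2 := by
    linear_combination (h2 - h1) / 2
  have h3 := hp.norm_order_le hα₀ hα₁ hw
  have h4 := hq.norm_sub_one_le hw
  rw [hy, norm_div, norm_mul]
  calc ‖α + (1 - α) * p w‖ * ‖q w - 1‖ / ‖(2 : ℂ)‖ ≤
        (1 + (1 - 2 * α) * ‖w‖) / (1 - ‖w‖) * (2 * ‖w‖ / (1 - ‖w‖)) / ‖(2 : ℂ)‖ := by
        gcongr
        exact (norm_nonneg _).trans h3
    _ = _ := by
        have : 1 - ‖w‖ ≠ 0 := by linarith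
        rw [Complex.norm_ofNat]
        field_simp

lemma le_norm_of_sub_add (hp : IsCaratheodory p) (hq : IsCaratheodory q)
    (hα₁ : α < 1) (hw : ‖w‖ < 1) (h1 : x - y = α + (1 - α) * p w)
    (h2 : x + y = (α + (1 - α) * p w) * q w) :
    (1 - (1 - 2 * α) * ‖w‖) / (1 + ‖w‖) ^ 2 ≤ ‖x‖ := by
  have hx : x = (α + (1 - α) * p w) * (q w + 1) / 2 := by
    linear_combination (h2 + h1) / 2
  have h3 := hp.le_norm_order hα₁ hw
  have h4 := hq.le_re hw
  have h5 : 2 / (1 + ‖w‖) ≤ ‖q w + 1‖ := by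
    refine le_trans ?_ (re_le_norm _)
    rw [add_re, one_re]
    calc 2 / (1 + ‖w‖) = (1 - ‖w‖) / (1 + ‖w‖) + 1 := by field_simp; ring
      _ ≤ _ := by gcongr
  rw [hx, norm_div, norm_mul]
  calc _ = (1 - (1 - 2 * α) * ‖w‖) / (1 + ‖w‖) * (2 / (1 + ‖w‖)) / ‖(2 : ℂ)‖ := by
        rw [Complex.norm_ofNat]
        field_simp
    _ ≤ _ := by gcongr

/-- `x = P (q + 1) / 2`, `y = P (q - 1) / 2` and `|q + 1|² - |q - 1|² = 4 Re q`. -/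
lemma sq_norm_sub_sq_norm_eq (h1 : x - y = α + (1 - α) * p w)
    (h2 : x + y = (α + (1 - α) * p w) * q w) :
    ‖x‖ ^ 2 - ‖y‖ ^ 2 = ‖α + (1 - α) * p w‖ ^ 2 * (q w).re := by
  have hx : x = (α + (1 - α) * p w) * (q w + 1) / 2 := by
    linear_combination (h2 + h1) / 2
  have hy : y = (α + (1 - α) * p w) * (q w - 1) / 2 := by
    linear_combination (h2 - h1) / 2
  have : ‖q w + 1‖ ^ 2 - ‖q w - 1‖ ^ 2 = 4 * (q w).re := by
    rw [← normSq_eq_norm_sq, ← normSq_eq_norm_sq, normSq_apply, normSq_apply]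
    simp
    ring
  rw [hx, hy, norm_div, norm_div, norm_mul, norm_mul, Complex.norm_ofNat]
  linear_combination ‖α + (1 - α) * p w‖ ^ 2 / 4 * this

/-- The difference is estimated as a whole. Separate bounds would need a positive lower bound for
`|y|`, which fails since `y` may vanish; the joint bound keeps the factor `1 - t²`. -/
lemma sq_norm_sub_sq_norm_le (hp : IsCaratheodory p) (hq : IsCaratheodory q) (hα₀ : 0 ≤ α)
    (hα₁ : α < 1) (hw : ‖w‖ < 1) (h1 : x - y = α + (1 - α) * p w)
    (h2 : x + y = (α + (1 - α) * p w) * q w) :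
    ‖x‖ ^ 2 - ‖y‖ ^ 2 ≤
      ((1 + (1 - 2 * α) * ‖w‖) / (1 - ‖w‖) ^ 2) ^ 2 * (1 - ‖w‖ ^ 2) := by
  have h3 := hp.norm_order_le hα₀ hα₁ hw
  have h4 := (re_le_norm _).trans (hq.norm_le hw)
  rw [sq_norm_sub_sq_norm_eq h1 h2]
  calc _ ≤ ((1 + (1 - 2 * α) * ‖w‖) / (1 - ‖w‖)) ^ 2 * ((1 + ‖w‖) / (1 - ‖w‖)) := by
        have := hq.re_pos w (mem_ball_zero_iff.2 hw)
        gcongr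
    _ = _ := by
        have : 1 - ‖w‖ ≠ 0 := by linarith
        field_simp
        ring

end Distortion

lemma sq_norm_sub_sq_norm_nonneg {p q : ℂ → ℂ} {α : ℝ} {w x y : ℂ} (hq : IsCaratheodory q)
    (hw : ‖w‖ < 1) (h1 : x - y = α + (1 - α) * p w)
    (h2 : x + y = (α + (1 - α) * p w) * q w) : 0 ≤ ‖x‖ ^ 2 - ‖y‖ ^ 2 := by
  rw [sq_norm_sub_sq_norm_eq h1 h2]
  exact mul_nonneg (sq_nonneg _) (hq.re_pos w (mem_ball_zero_iff.2 hw)).le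

/-! ### Wirtinger derivatives and logarithmic coordinates -/

/-- The real-linear map `v ↦ a v + b v̄`. -/
noncomputable def wirtingerMap (a b : ℂ) : ℂ →L[ℝ] ℂ :=
  a • (ContinuousLinearMap.id ℝ ℂ) + b • (conjCLE : ℂ →L[ℝ] ℂ)

@[simp] lemma wirtingerMap_apply (a b v : ℂ) : wirtingerMap a b v = a * v + b * conj v := by
  simp [wirtingerMap]

lemma det_wirtingerMap (a b : ℂ) : (wirtingerMap a b).det = ‖a‖ ^ 2 - ‖b‖ ^ 2 := by
  rw [ContinuousLinearMap.det, ← LinearMap.det_toMatrix basisOneI, Matrix.det_fin_two]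
  simp only [LinearMap.toMatrix_apply, coe_basisOneI, coe_basisOneI_repr,
    ContinuousLinearMap.coe_coe, wirtingerMap_apply]
  rw [← normSq_eq_norm_sq, ← normSq_eq_norm_sq, normSq_apply, normSq_apply]
  simp
  ring

lemma HasFDerivAt.dz_eq {f : ℂ → ℂ} {a b z : ℂ} (h : HasFDerivAt f (wirtingerMap a b) z) :
    Logharmonic.dz f z = a := by
  rw [Logharmonic.dz, h.fderiv]
  simp only [wirtingerMap_apply, map_one, conj_I]
  linear_combination (b - a) / 2 * I_sq

lemma HasFDerivAt.dzbar_eq {f : ℂ → ℂ} {a b z : ℂ} (h : HasFDerivAt f (wirtingerMap a b) z) :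
    Logharmonic.dzbar f z = b := by
  rw [Logharmonic.dzbar, h.fderiv]
  simp only [wirtingerMap_apply, map_one, conj_I]
  linear_combination (a - b) / 2 * I_sq

lemma HasDerivAt.hasFDerivAt_mul_conj {m g : ℂ → ℂ} {m' g' z : ℂ} (hm : HasDerivAt m m' z)
    (hg : HasDerivAt g g' z) :
    HasFDerivAt (fun x => m x * conj (g x))
      (wirtingerMap (m' * conj (g z)) (m z * conj g')) z := by
  have h1 := hm.hasFDerivAt.restrictScalars ℝ
  have h2 := (conjCLE : ℂ →L[ℝ] ℂ).hasFDerivAt.comp z (hg.hasFDerivAt.restrictScalars ℝ)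
  refine (h1.mul h2).congr_fderiv ?_
  ext v
  simp
  ring

/-- A power series in `z ^ k` without constant term is a holomorphic function of `z ^ k`. -/
lemma Logharmonic.IsExpKSeries.exists_eq_exp {k : ℕ} (hk : 1 ≤ k) {h : ℂ → ℂ}
    (hh : Logharmonic.IsExpKSeries k h) :
    ∃ A : ℂ → ℂ, DifferentiableOn ℂ A (ball 0 1) ∧ A 0 = 0 ∧
      ∀ z ∈ ball (0 : ℂ) 1, h z = exp (A (z ^ k)) := by
  obtain ⟨a, ha⟩ := hh
  -- Every `w` in the disk is `z ^ k` with `z` in the disk, so convergence of the series in `z`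
  -- gives convergence in `w`.
  have hsum : ∀ w ∈ ball (0 : ℂ) 1, Summable fun n : ℕ => a ((n + 1) * k) * w ^ (n + 1) := by
    intro w hw
    obtain ⟨z, rfl⟩ := IsAlgClosed.exists_pow_nat_eq w hk
    have hz : z ∈ ball (0 : ℂ) 1 := by
      rw [mem_ball_zero_iff, norm_pow] at hw
      exact mem_ball_zero_iff.2 ((pow_lt_one_iff_of_nonneg (norm_nonneg _) (by lia)).1 hw)
    obtain ⟨s, hs, -⟩ := ha z hz
    simpa only [mul_comm _ k, pow_mul] using hs.summable
  refine ⟨fun w => ∑' n : ℕ, a ((n + 1) * k) * w ^ (n + 1), ?_, by simp, ?_⟩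
  · intro w hw
    rw [mem_ball_zero_iff] at hw
    obtain ⟨r, hr, hr1⟩ := exists_between hw
    have hr0 : 0 ≤ r := (norm_nonneg _).trans hr.le
    have hrmem : (r : ℂ) ∈ ball (0 : ℂ) 1 := by
      rw [mem_ball_zero_iff, norm_real, Real.norm_of_nonneg hr0]; exact hr1
    have hd : DifferentiableOn ℂ (fun w => ∑' n : ℕ, a ((n + 1) * k) * w ^ (n + 1)) (ball 0 r) := by
      refine Complex.differentiableOn_tsum_of_summable_norm (summable_norm_iff.2 (hsum r hrmem))
        (fun n => by fun_prop) isOpen_ball fun n x hx => ?_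
      rw [mem_ball_zero_iff] at hx
      rw [norm_mul, norm_mul, norm_pow, norm_pow, norm_real, Real.norm_of_nonneg hr0]
      gcongr
    exact (hd.differentiableAt (isOpen_ball.mem_nhds (mem_ball_zero_iff.2 hr))).differentiableWithinAt
  · intro z hz
    obtain ⟨s, hs, hhs⟩ := ha z hz
    rw [hhs]
    congr 1
    simp only [mul_comm _ k, pow_mul] at hs
    simpa only [mul_comm _ k] using hs.tsum_eq.symm

lemma pow_mem_ball_zero_one {k : ℕ} (hk : 1 ≤ k) {z : ℂ} (hz : z ∈ ball (0 : ℂ) 1) :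
    z ^ k ∈ ball (0 : ℂ) 1 := by
  rw [mem_ball_zero_iff] at hz ⊢
  rw [norm_pow]
  exact pow_lt_one₀ (norm_nonneg _) hz (by lia)

lemma hasDerivAt_exp_comp_pow (k : ℕ) {A : ℂ → ℂ} {z : ℂ} (hA : DifferentiableAt ℂ A (z ^ k)) :
    HasDerivAt (fun x => exp (A (x ^ k)))
      (exp (A (z ^ k)) * (deriv A (z ^ k) * (k * z ^ (k - 1)))) z :=
  (hA.hasDerivAt.comp z (hasDerivAt_pow k z)).cexp

namespace Logharmonic.SLHkStar

variable {k : ℕ} {α : ℝ} {f : ℂ → ℂ}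

/-- The data of a mapping of class `S_LH^{k*}(α)` in terms of the logarithms of `h` and `g` as
functions of `z ^ k`. -/
theorem exists_logarithms (hf : SLHkStar k α f) (hk : 1 ≤ k) :
    ∃ A B : ℂ → ℂ, DifferentiableOn ℂ A (ball 0 1) ∧ DifferentiableOn ℂ B (ball 0 1) ∧
      A 0 = 0 ∧ B 0 = 0 ∧
      (∀ z ∈ ball (0 : ℂ) 1, ∃ a b : ℂ, HasFDerivAt f (wirtingerMap a b) z ∧
        ‖a‖ = ‖exp (A (z ^ k) + B (z ^ k))‖ * ‖1 + k * (z ^ k * deriv A (z ^ k))‖ ∧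
        ‖b‖ = ‖exp (A (z ^ k) + B (z ^ k))‖ * ‖k * (z ^ k * deriv B (z ^ k))‖) ∧
      (∀ w ∈ ball (0 : ℂ) 1, w ≠ 0 →
        α < (1 + k * (w * deriv A w) - k * (w * deriv B w)).re) ∧
      ∀ w ∈ ball (0 : ℂ) 1, w ≠ 0 → ∃ ω : ℂ, ‖ω‖ < 1 ∧
        k * (w * deriv B w) = ω * (1 + k * (w * deriv A w)) := by
  obtain ⟨h, g, -, -, hh, hg, hfe⟩ := hf.form
  obtain ⟨A, hA, hA0, hAe⟩ := hh.exists_eq_exp hk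
  obtain ⟨B, hB, hB0, hBe⟩ := hg.exists_eq_exp hk
  obtain ⟨ω, -, hω1, hω⟩ := hf.logharmonic
  have hfz : ∀ z ∈ ball (0 : ℂ) 1,
      f z = z * exp (A (z ^ k)) * conj (exp (B (z ^ k))) := fun z hz => by
    rw [hfe z hz, hAe z hz, hBe z hz]
  have hpow : ∀ z : ℂ, (z : ℂ) * z ^ (k - 1) = z ^ k := fun z => mul_pow_sub_one (by lia) z
  have hder : ∀ z ∈ ball (0 : ℂ) 1, HasFDerivAt f (wirtingerMap
      (exp (A (z ^ k)) * (1 + k * (z ^ k * deriv A (z ^ k))) * conj (exp (B (z ^ k))))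
      (z * exp (A (z ^ k)) *
        conj (exp (B (z ^ k)) * (deriv B (z ^ k) * (k * z ^ (k - 1)))))) z := by
    intro z hz
    have hw := isOpen_ball.mem_nhds (pow_mem_ball_zero_one hk hz)
    have h1 := ((hasDerivAt_id' z).mul
      (hasDerivAt_exp_comp_pow k (hA.differentiableAt hw))).hasFDerivAt_mul_conj
      (hasDerivAt_exp_comp_pow k (hB.differentiableAt hw))
    refine HasFDerivAt.congr_of_eventuallyEq ?_
      (Filter.eventuallyEq_of_mem (isOpen_ball.mem_nhds hz) hfz)
    refine h1.congr_fderiv ?_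
    congr 2
    linear_combination exp (A (z ^ k)) * deriv A (z ^ k) * k * hpow z
  have hroot : ∀ w ∈ ball (0 : ℂ) 1, w ≠ 0 → ∃ z ∈ ball (0 : ℂ) 1, z ≠ 0 ∧ z ^ k = w := by
    intro w hw hw0
    obtain ⟨z, rfl⟩ := IsAlgClosed.exists_pow_nat_eq w hk
    rw [mem_ball_zero_iff, norm_pow] at hw
    refine ⟨z, mem_ball_zero_iff.2 ((pow_lt_one_iff_of_nonneg (norm_nonneg _) (by lia)).1 hw),
      ?_, rfl⟩
    rintro rfl
    exact hw0 (zero_pow (by lia))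
  refine ⟨A, B, hA, hB, hA0, hB0, fun z hz => ⟨_, _, hder z hz, ?_, ?_⟩, ?_, ?_⟩
  · rw [Complex.exp_add]
    simp only [norm_mul, RCLike.norm_conj]
    ring
  · rw [Complex.exp_add]
    simp only [norm_mul, RCLike.norm_conj, ← hpow z]
    ring
  · intro w hw hw0
    obtain ⟨z, hz, hz0, rfl⟩ := hroot w hw hw0
    have h1 := hf.starlike z hz hz0
    rw [(hder z hz).dz_eq, (hder z hz).dzbar_eq, hfz z hz] at h1
    have e : (z * (exp (A (z ^ k)) * (1 + k * (z ^ k * deriv A (z ^ k))) *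
        conj (exp (B (z ^ k)))) - conj z * (z * exp (A (z ^ k)) *
        conj (exp (B (z ^ k)) * (deriv B (z ^ k) * (k * z ^ (k - 1)))))) /
        (z * exp (A (z ^ k)) * conj (exp (B (z ^ k)))) =
        (1 + k * (z ^ k * deriv A (z ^ k))) - conj (k * (z ^ k * deriv B (z ^ k))) := by
      have h2 := exp_ne_zero (A (z ^ k))
      have h3 : conj (exp (B (z ^ k))) ≠ 0 :=
        (map_ne_zero (starRingEnd ℂ)).2 (exp_ne_zero _)
      have h4 : conj z * conj (z ^ (k - 1)) = conj (z ^ k) := by rw [← map_mul, hpow]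
      rw [div_eq_iff (mul_ne_zero (mul_ne_zero hz0 h2) h3)]
      simp only [map_mul, ← h4]
      ring
    -- The antiholomorphic term enters as `conj G`; only its real part matters, so the condition
    -- becomes one on the holomorphic function `H - G`.
    rw [e, sub_re, conj_re, ← sub_re] at h1
    exact h1
  · intro w hw hw0
    obtain ⟨z, hz, hz0, rfl⟩ := hroot w hw hw0
    have h2 := exp_ne_zero (A (z ^ k))
    have h3 : conj (exp (B (z ^ k))) ≠ 0 := (map_ne_zero (starRingEnd ℂ)).2 (exp_ne_zero _)
    have hf0 : f z ≠ 0 := by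
      rw [hfz z hz]
      exact mul_ne_zero (mul_ne_zero hz0 h2) h3
    have h1 := (hω z hz hf0).2
    rw [(hder z hz).dz_eq, (hder z hz).dzbar_eq, hfz z hz] at h1
    refine ⟨ω z, hω1 z hz, ?_⟩
    simp only [map_mul, conj_conj] at h1
    have h5 : conj z ≠ 0 := (map_ne_zero (starRingEnd ℂ)).2 hz0
    have h6 : conj (exp (A (z ^ k))) ≠ 0 := (map_ne_zero (starRingEnd ℂ)).2 h2
    have h7 := exp_ne_zero (B (z ^ k))
    rw [mul_div_mul_left _ _ (mul_ne_zero h5 h6), mul_div_cancel_left₀ _ h7,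
      mul_div_mul_right _ _ h3, mul_comm z, mul_div_mul_left _ _ h2, mul_div_assoc', eq_div_iff hz0]
      at h1
    rw [← h1, ← hpow z]
    ring

end Logharmonic.SLHkStar

/-! ### Area of the image in polar coordinates -/

lemma setIntegral_ball_fun_norm {r : ℝ} (hr : 0 ≤ r) (φ : ℝ → ℝ) :
    ∫ z in ball (0 : ℂ) r, φ ‖z‖ = 2 * π * ∫ ρ in (0 : ℝ)..r, φ ρ * ρ := by
  have h1 : ∫ z in ball (0 : ℂ) r, φ ‖z‖ = ∫ z : ℂ, (Iio r).indicator φ ‖z‖ := by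
    rw [← integral_indicator measurableSet_ball]
    congr 1
    ext z
    simp [indicator]
  have hπ : (volume : Measure ℂ).real (ball 0 1) = π := by
    simp [Measure.real, Complex.volume_ball]
  rw [h1, integral_fun_norm_addHaar volume ((Iio r).indicator φ), Complex.finrank_real_complex, hπ,
    intervalIntegral.integral_of_le hr, integral_Ioc_eq_integral_Ioo]
  have h2 : ∀ y : ℝ, y ^ (2 - 1) • (Iio r).indicator φ y =
      (Iio r).indicator (fun ρ => φ ρ * ρ) y := by
    intro y
    by_cases h : y ∈ Iio r <;> simp [h, mul_comm]
  simp only [h2]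
  rw [setIntegral_indicator measurableSet_Iio, Ioi_inter_Iio]
  simp
  ring

lemma ContinuousOn.integrableOn_ball_comp_norm {r : ℝ} {φ : ℝ → ℝ}
    (hφ : ContinuousOn φ (Icc 0 r)) : IntegrableOn (fun z : ℂ => φ ‖z‖) (ball 0 r) := by
  have h : ContinuousOn (fun z : ℂ => φ ‖z‖) (closedBall 0 r) :=
    hφ.comp (by fun_prop) fun z hz => ⟨norm_nonneg z, mem_closedBall_zero_iff.1 hz⟩
  exact (h.integrableOn_compact (isCompact_closedBall 0 r)).mono_set ball_subset_closedBall

/-- Radial bounds for the Jacobian of an injective map give bounds for the area of the image of a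
disk. -/
theorem volume_image_ball_bounds {f : ℂ → ℂ} {f' : ℂ → ℂ →L[ℝ] ℂ} {r : ℝ} (hr : 0 ≤ r)
    (hf : InjOn f (ball 0 r)) (hf' : ∀ z ∈ ball (0 : ℂ) r, HasFDerivAt f (f' z) z)
    {φ₁ φ₂ : ℝ → ℝ} (hφ₁ : ContinuousOn φ₁ (Icc 0 r)) (hφ₂ : ContinuousOn φ₂ (Icc 0 r))
    (h₁ : ∀ z ∈ ball (0 : ℂ) r, φ₁ ‖z‖ ≤ |(f' z).det|)
    (h₂ : ∀ z ∈ ball (0 : ℂ) r, |(f' z).det| ≤ φ₂ ‖z‖) :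
    volume (f '' ball 0 r) ≠ ⊤ ∧
      2 * π * ∫ ρ in (0 : ℝ)..r, φ₁ ρ * ρ ≤ (volume (f '' ball 0 r)).toReal ∧
      (volume (f '' ball 0 r)).toReal ≤ 2 * π * ∫ ρ in (0 : ℝ)..r, φ₂ ρ * ρ := by
  have hi₁ := hφ₁.integrableOn_ball_comp_norm
  have hi₂ := hφ₂.integrableOn_ball_comp_norm
  have hvol := lintegral_abs_det_fderiv_eq_addHaar_image volume measurableSet_ball
    (fun z hz => (hf' z hz).hasFDerivWithinAt) hf
  have hnn : 0 ≤ᵐ[volume.restrict (ball 0 r)] fun z : ℂ => φ₂ ‖z‖ := by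
    filter_upwards [ae_restrict_mem measurableSet_ball] with z hz
    exact (abs_nonneg _).trans (h₂ z hz)
  have hle : volume (f '' ball 0 r) ≤ ENNReal.ofReal (∫ z in ball (0 : ℂ) r, φ₂ ‖z‖) := by
    rw [← hvol, ofReal_integral_eq_lintegral_ofReal hi₂ hnn]
    exact setLIntegral_mono' measurableSet_ball fun z hz => ENNReal.ofReal_le_ofReal (h₂ z hz)
  have htop : volume (f '' ball 0 r) ≠ ⊤ := (hle.trans_lt ENNReal.ofReal_lt_top).ne
  refine ⟨htop, ?_, ?_⟩
  -- `φ₁` may be negative; its negative part is discarded and its positive part is still below the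
  -- absolute Jacobian.
  · rw [← setIntegral_ball_fun_norm hr, integral_eq_lintegral_pos_part_sub_lintegral_neg_part hi₁]
    refine (sub_le_self _ ENNReal.toReal_nonneg).trans (ENNReal.toReal_mono htop ?_)
    rw [← hvol]
    exact setLIntegral_mono' measurableSet_ball fun z hz => ENNReal.ofReal_le_ofReal (h₁ z hz)
  · rw [← setIntegral_ball_fun_norm hr]
    exact ENNReal.toReal_le_of_le_ofReal (integral_nonneg_of_ae hnn) hle

/-! ### Jacobian bounds and conclusion -/

/-- Since `2(α + k)/k = 2 + 2α/k`, the power splits into the square from the distortion bounds and a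
factor `x ^ (2α/k)`. Moved into the exponential, the latter is the logarithmic term in the bounds on
`k (A + B)`. -/
lemma sq_div_rpow_mul_exp {x k : ℝ} (hx : 0 < x) (hk : k ≠ 0) (N α y : ℝ) :
    (N / x ^ (2 * (α + k) / k)) ^ 2 * Real.exp y =
      (N / x ^ 2) ^ 2 * Real.exp (y - 4 * α / k * Real.log x) := by
  have h1 : x ^ (2 * (α + k) / k) = x ^ 2 * Real.exp (2 * α / k * Real.log x) := by
    rw [show 2 * (α + k) / k = 2 + 2 * α / k by field_simp; ring, Real.rpow_add hx,
      Real.rpow_ofNat, Real.rpow_def_of_pos hx (2 * α / k), mul_comm (Real.log x)]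
  have h2 : Real.exp (y - 4 * α / k * Real.log x) =
      Real.exp y / Real.exp (2 * α / k * Real.log x) ^ 2 := by
    rw [Real.exp_sub, ← Real.exp_nat_mul]
    congr 2
    push_cast
    ring
  rw [h1, h2]
  field_simp

namespace Logharmonic

variable {k : ℕ} {α : ℝ}

/-- Upper bound for the squared modulus of the analytic derivative at distance `ρ`. -/
noncomputable def upperDeriv (k : ℕ) (α ρ : ℝ) : ℝ :=
  ((1 + (1 - 2 * α) * ρ ^ k) / (1 - ρ ^ k) ^ (2 * (α + k) / k)) ^ 2 *
    Real.exp (8 * (1 - α) * ρ ^ k / (k * (1 - ρ ^ k)))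

/-- Lower bound for the squared modulus of the analytic derivative at distance `ρ`. -/
noncomputable def lowerDeriv (k : ℕ) (α ρ : ℝ) : ℝ :=
  ((1 - (1 - 2 * α) * ρ ^ k) / (1 + ρ ^ k) ^ (2 * (α + k) / k)) ^ 2 *
    Real.exp (-8 * (1 - α) * ρ ^ k / (k * (1 + ρ ^ k)))

lemma one_sub_pow_pos (hk : 1 ≤ k) {ρ : ℝ} (h0 : 0 ≤ ρ) (h1 : ρ < 1) : 0 < 1 - ρ ^ k :=
  sub_pos.2 (pow_lt_one₀ h0 h1 (by lia))

lemma continuousOn_upperDeriv (hk : 1 ≤ k) {r : ℝ} (hr : r < 1) :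
    ContinuousOn (upperDeriv k α) (Icc 0 r) := by
  have hpos : ∀ ρ ∈ Icc (0 : ℝ) r, 0 < 1 - ρ ^ k := fun ρ hρ =>
    one_sub_pow_pos hk hρ.1 (hρ.2.trans_lt hr)
  have hk0 : (0 : ℝ) < k := by exact_mod_cast hk
  refine ContinuousOn.mul (ContinuousOn.pow (ContinuousOn.div (by fun_prop) ?_ ?_) 2)
    (Real.continuous_exp.comp_continuousOn (ContinuousOn.div (by fun_prop) (by fun_prop) ?_))
  · exact ContinuousOn.rpow_const (by fun_prop) fun ρ hρ => Or.inl (hpos ρ hρ).ne'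
  · exact fun ρ hρ => (Real.rpow_pos_of_pos (hpos ρ hρ) _).ne'
  · exact fun ρ hρ => (mul_pos hk0 (hpos ρ hρ)).ne'

lemma continuousOn_lowerDeriv (hk : 1 ≤ k) (r : ℝ) :
    ContinuousOn (lowerDeriv k α) (Icc 0 r) := by
  have hpos : ∀ ρ ∈ Icc (0 : ℝ) r, 0 < 1 + ρ ^ k := fun ρ hρ => by
    have := pow_nonneg hρ.1 k
    positivity
  have hk0 : (0 : ℝ) < k := by exact_mod_cast hk
  refine ContinuousOn.mul (ContinuousOn.pow (ContinuousOn.div (by fun_prop) ?_ ?_) 2)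
    (Real.continuous_exp.comp_continuousOn (ContinuousOn.div (by fun_prop) (by fun_prop) ?_))
  · exact ContinuousOn.rpow_const (by fun_prop) fun ρ hρ => Or.inl (hpos ρ hρ).ne'
  · exact fun ρ hρ => (Real.rpow_pos_of_pos (hpos ρ hρ) _).ne'
  · exact fun ρ hρ => (mul_pos hk0 (hpos ρ hρ)).ne'

lemma L₁_eq (hk : 1 ≤ k) {r : ℝ} (hr₀ : 0 ≤ r) (hr₁ : r < 1) :
    L₁ k α r =
      ∫ ρ in (0 : ℝ)..r, (lowerDeriv k α ρ - (ρ ^ k) ^ 2 * upperDeriv k α ρ) * ρ := by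
  have hu := continuousOn_upperDeriv (α := α) hk hr₁
  have hl := continuousOn_lowerDeriv (α := α) hk r
  rw [← uIcc_of_le hr₀] at hu hl
  rw [L₁, ← intervalIntegral.integral_sub]
  · refine intervalIntegral.integral_congr fun ρ _ => ?_
    simp only [lowerDeriv, upperDeriv]
    ring
  · exact (hl.mul continuousOn_id).intervalIntegrable
  · refine (((((continuous_pow k).pow 2).continuousOn.mul hu).mul
      continuousOn_id).congr fun ρ _ => ?_).intervalIntegrable
    simp only [upperDeriv, id, mul_div_assoc, Pi.mul_apply, Pi.pow_apply]
    ring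

lemma L₂_eq (hk : 1 ≤ k) {r : ℝ} (hr₀ : 0 ≤ r) (hr₁ : r < 1) :
    L₂ k α r =
      ∫ ρ in (0 : ℝ)..r, (upperDeriv k α ρ - (ρ ^ k) ^ 2 * lowerDeriv k α ρ) * ρ := by
  have hu := continuousOn_upperDeriv (α := α) hk hr₁
  have hl := continuousOn_lowerDeriv (α := α) hk r
  rw [← uIcc_of_le hr₀] at hu hl
  rw [L₂, ← intervalIntegral.integral_sub]
  · refine intervalIntegral.integral_congr fun ρ _ => ?_
    simp only [lowerDeriv, upperDeriv]
    ring
  · exact (hu.mul continuousOn_id).intervalIntegrable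
  · refine (((((continuous_pow k).pow 2).continuousOn.mul hl).mul
      continuousOn_id).congr fun ρ _ => ?_).intervalIntegrable
    simp only [lowerDeriv, id, mul_div_assoc, Pi.mul_apply, Pi.pow_apply]
    ring

/-- The Jacobian of a mapping of class `S_LH^{k*}(α)` lies between radial bounds. -/
theorem SLHkStar.exists_jacobian_bounds {f : ℂ → ℂ} (hf : SLHkStar k α f) (hk : 1 ≤ k)
    (hα₀ : 0 ≤ α) (hα₁ : α < 1) {z : ℂ} (hz : z ∈ ball (0 : ℂ) 1) :
    ∃ a b : ℂ, HasFDerivAt f (wirtingerMap a b) z ∧ 0 ≤ ‖a‖ ^ 2 - ‖b‖ ^ 2 ∧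
      lowerDeriv k α ‖z‖ - (‖z‖ ^ k) ^ 2 * upperDeriv k α ‖z‖ ≤ ‖a‖ ^ 2 - ‖b‖ ^ 2 ∧
      ‖a‖ ^ 2 - ‖b‖ ^ 2 ≤ upperDeriv k α ‖z‖ - (‖z‖ ^ k) ^ 2 * lowerDeriv k α ‖z‖ := by
  obtain ⟨A, B, hA, hB, hA0, hB0, hder, hre, hω⟩ := hf.exists_logarithms hk
  have hk0 : (0 : ℝ) < k := by exact_mod_cast hk
  have hA' := hA.deriv isOpen_ball
  have hB' := hB.deriv isOpen_ball
  obtain ⟨p, q, hp, hq, hpq⟩ := exists_isCaratheodory_of_dilatation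
    (H := fun w => 1 + k * (w * deriv A w)) (G := fun w => k * (w * deriv B w)) hα₀ hα₁
    (((differentiableOn_id.mul hA').const_mul _).const_add _)
    ((differentiableOn_id.mul hB').const_mul _) (by simp) (by simp) hre hω
  have hE : DifferentiableOn ℂ (fun w => k * (A w + B w)) (ball 0 1) :=
    (hA.add hB).const_mul _
  have hEd : ∀ w ∈ ball (0 : ℂ) 1, w * deriv (fun w => k * (A w + B w)) w =
      (α + (1 - α) * p w) * q w - 1 := by
    intro w hw
    have hw' := isOpen_ball.mem_nhds hw
    have h1 := (((hA.differentiableAt hw').hasDerivAt.add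
      (hB.differentiableAt hw').hasDerivAt).const_mul (k : ℂ)).deriv
    rw [← (hpq w hw).2]
    refine Eq.trans (congrArg (w * ·) h1) ?_
    ring
  obtain ⟨a, b, hfd, ha, hb⟩ := hder z hz
  have hw := pow_mem_ball_zero_one hk hz
  set w := z ^ k with hwz
  obtain ⟨h1, h2⟩ := hpq w hw
  rw [mem_ball_zero_iff] at hw
  have hup := hp.re_primitive_le hq hα₀ hα₁ hE (by simp [hA0, hB0]) hEd hw
  have hlo := hp.le_re_primitive hq hα₀ hα₁ hE (by simp [hA0, hB0]) hEd hw
  rw [← ofReal_natCast k, re_ofReal_mul] at hup hlo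
  have hG := norm_le_of_sub_add hp hq hα₀ hα₁ hw h1 h2
  have hH := le_norm_of_sub_add hp hq hα₁ hw h1 h2
  have hHG := sq_norm_sub_sq_norm_le hp hq hα₀ hα₁ hw h1 h2
  have hHG0 := sq_norm_sub_sq_norm_nonneg hq hw h1 h2
  set x : ℝ := ‖1 + k * (w * deriv A w)‖
  set y : ℝ := ‖k * (w * deriv B w)‖
  have hzk : ‖z‖ ^ k = ‖w‖ := by rw [hwz, norm_pow]
  set t : ℝ := ‖w‖
  have ht0 : 0 ≤ t := norm_nonneg _
  set S : ℝ := (A w + B w).re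
  set U : ℝ := (1 + (1 - 2 * α) * t) / (1 - t) ^ 2
  set V : ℝ := (1 - (1 - 2 * α) * t) / (1 + t) ^ 2
  set e : ℝ := Real.exp (2 * S) with he
  have hV0 : 0 ≤ V := div_nonneg (by nlinarith) (by positivity)
  have hy0 : 0 ≤ y := norm_nonneg _
  have hupper : upperDeriv k α ‖z‖ =
      U ^ 2 * Real.exp (8 * (1 - α) * t / (k * (1 - t)) - 4 * α / k * Real.log (1 - t)) := by
    rw [upperDeriv, hzk, sq_div_rpow_mul_exp (by linarith) hk0.ne']
  have hlower : lowerDeriv k α ‖z‖ =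
      V ^ 2 * Real.exp (-8 * (1 - α) * t / (k * (1 + t)) - 4 * α / k * Real.log (1 + t)) := by
    rw [lowerDeriv, hzk, sq_div_rpow_mul_exp (by linarith) hk0.ne']
  have hU : e * U ^ 2 ≤ upperDeriv k α ‖z‖ := by
    rw [hupper, mul_comm]
    refine mul_le_mul_of_nonneg_left (Real.exp_le_exp.2 ?_) (sq_nonneg _)
    have ht1 : 1 - t ≠ 0 := by linarith
    -- The growth bound concerns `Re k(A + B) = k S`, while the Jacobian contains `|hg|² = exp
    -- (2S)`; hence the factor `2 / k`.
    calc 2 * S = 2 / k * (k * S) := by field_simp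
      _ ≤ 2 / k * (4 * (1 - α) * t / (1 - t) - 2 * α * Real.log (1 - t)) := by gcongr
      _ = _ := by field_simp; ring
  have hV : lowerDeriv k α ‖z‖ ≤ e * V ^ 2 := by
    rw [hlower, mul_comm e]
    refine mul_le_mul_of_nonneg_left (Real.exp_le_exp.2 ?_) (sq_nonneg _)
    calc _ = 2 / k * (-(4 * (1 - α) * t / (1 + t)) - 2 * α * Real.log (1 + t)) := by
          field_simp; ring
      _ ≤ 2 / k * (k * S) := by gcongr
      _ = 2 * S := by field_simp
  have hexp : ‖exp (A w + B w)‖ ^ 2 = e := by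
    rw [norm_exp, ← Real.exp_nat_mul, he]; push_cast; rfl
  have hJ : ‖a‖ ^ 2 - ‖b‖ ^ 2 = e * (x ^ 2 - y ^ 2) := by
    rw [ha, hb, mul_pow, mul_pow, hexp]; ring
  have he0 : 0 < e := Real.exp_pos _
  have hx2 : V ^ 2 ≤ x ^ 2 := pow_le_pow_left₀ hV0 hH 2
  have hy2 : y ^ 2 ≤ t ^ 2 * U ^ 2 := by rw [← mul_pow]; exact pow_le_pow_left₀ hy0 hG 2
  refine ⟨a, b, hfd, ?_, ?_, ?_⟩
  · rw [hJ]; exact mul_nonneg he0.le hHG0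
  · rw [hJ, hzk]
    have h3 := mul_le_mul_of_nonneg_left hx2 he0.le
    have h4 := mul_le_mul_of_nonneg_left hy2 he0.le
    have h5 := mul_le_mul_of_nonneg_left hU (sq_nonneg t)
    linarith
  · rw [hJ, hzk]
    -- The joint bound gives `(1 - t²)` times `upperDeriv`; replacing the subtracted `upperDeriv` by
    -- the smaller `lowerDeriv` only weakens it. `V² ≤ U²` comes from `V ≤ |H|`, `|G| ≤ t U` and the
    -- bound on `|H|² - |G|²`.
    have hVU : V ^ 2 ≤ U ^ 2 := by linarith
    have h3 := mul_le_mul_of_nonneg_left hHG he0.le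
    have h4 : lowerDeriv k α ‖z‖ ≤ upperDeriv k α ‖z‖ :=
      hV.trans ((mul_le_mul_of_nonneg_left hVU he0.le).trans hU)
    have h5 := mul_le_mul_of_nonneg_left h4 (sq_nonneg t)
    have h6 := mul_le_mul_of_nonneg_right hU (show 0 ≤ 1 - t ^ 2 by nlinarith)
    linarith

end Logharmonic

theorem mainTheorem7 (k : ℕ) (hk : 1 ≤ k) (α : ℝ) (hα₀ : 0 ≤ α) (hα₁ : α < 1)
    (f : ℂ → ℂ) (hf : Logharmonic.SLHkStar k α f) (r : ℝ) (hr₀ : 0 ≤ r) (hr₁ : r < 1) :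
    MeasureTheory.volume (f '' Metric.ball (0 : ℂ) r) ≠ ⊤ ∧
      2 * Real.pi * Logharmonic.L₁ k α r ≤
        (MeasureTheory.volume (f '' Metric.ball (0 : ℂ) r)).toReal ∧
      (MeasureTheory.volume (f '' Metric.ball (0 : ℂ) r)).toReal ≤
        2 * Real.pi * Logharmonic.L₂ k α r := by
  have hsub : ball (0 : ℂ) r ⊆ ball 0 1 := ball_subset_ball hr₁.le
  choose! a b hfd h0 hlo hup using fun z (hz : z ∈ ball (0 : ℂ) r) =>
    hf.exists_jacobian_bounds hk hα₀ hα₁ (hsub hz)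
  have hu := Logharmonic.continuousOn_upperDeriv (α := α) hk hr₁
  have hl := Logharmonic.continuousOn_lowerDeriv (α := α) hk r
  have hpow : ContinuousOn (fun ρ : ℝ => (ρ ^ k) ^ 2) (Icc 0 r) := by fun_prop
  rw [Logharmonic.L₁_eq hk hr₀ hr₁, Logharmonic.L₂_eq hk hr₀ hr₁]
  refine volume_image_ball_bounds hr₀ (hf.univalent.mono hsub) hfd (hl.sub (hpow.mul hu))
    (hu.sub (hpow.mul hl)) ?_ ?_
  · intro z hz
    rw [det_wirtingerMap, abs_of_nonneg (h0 z hz)]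
    exact hlo z hz
  · intro z hz
    rw [det_wirtingerMap, abs_of_nonneg (h0 z hz)]
    exact hup z hz
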